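/- Consider $T$ rounds of a repeated first-price auction. In round $t$ the bidder has a private value $v_t\in[0,1]$, the highest competing bid is $m_t\in[0,1]$, and a bid $b$ earns $r(b;v_t,m_t)=(v_t-b)\mathbf 1\{b\ge m_t\}$. Before bidding, the bidder observes $v_t$ and a hint interval $(h_t,\sigma_t)$ with $h_t\in[0,1]$, $\sigma_t\ge 0$; after bidding she observes $m_t$. A policy $\pi$ is randomized: it chooses the distribution of $b_t\in[0,v_t]$ from $(v_s,h_s,\sigma_s)_{s\le t}$ and $(m_s)_{s<t}$. An environment with parameters $(T,q,L)$ consists of numbers $v_t\in[0,1]$ and $\sigma_t\ge0$ with $\sum_{t=1}^T\sigma_t=L$, and an arbitrary joint law of $(m_t,h_t)_{t\le T}$ with $\mathbb E|h_t-m_t|^q\le\sigma_t^q$ for every $t$. Let $$\mathrm{Reg}(\pi)=\mathbb E\Big[\max_{a\in\mathcal F}\sum_{t=1}^T r(a(v_t);v_t,m_t)\Big]-\sum_{t=1}^T\mathbb E\,[r(b_t;v_t,m_t)],$$ where $\mathcal F$ is the set of increasing 1-Lipschitz functions $[0,1]\to[0,1]$, and let $R^*(T,q,L)=\inf_\pi\sup\mathrm{Reg}(\pi)$,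 the supremum being over all environments with parameters $(T,q,L)$. Theorem. For all $T\in\mathbb N$, $L\in[1,T]$ and $q\in[1,\infty)$, $$R^*(T,q,L)=\widetilde\Theta\Big(\min\big\{T^{\frac1{q+1}}L^{\frac q{q+1}},\sqrt T\big\}\Big),$$ that is, there are universal constants $c,C>0$ and $k\in\mathbb N$, independent of $T,L,q$, such that, with $\ell=(1+\log T)^k$ and $\rho=\min\{T^{1/(q+1)}L^{q/(q+1)},\sqrt T\}$, one has $c\,\rho/\ell\le R^*(T,q,L)\le C\,\ell\,\rho$. Moreover, up to the factor $C\,\ell$, one of two simple strategies is minimax optimal: if $T^{1/(q+1)}L^{q/(q+1)}\le\sqrt T$, the policy that only bids the hint, $b_t=\min\{v_t,\;h_t+\sigma_t^{q/(q+1)}\}$, has worst-case regret at most $C\,\ell\,R^*(T,q,L)$; if $T^{1/(q+1)}L^{q/(q+1)}\ge\sqrt T$, some policy that does not use $(h_t,\sigma_t)$ at all has worst-case regret at most $C\,\ell\,R^*(T,q,L)$. -/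

import Mathlib

open MeasureTheory ProbabilityTheory unitInterval

noncomputable section

namespace FirstPriceAuction

/-- Instantaneous reward of the bid `b` when the private value is `v` and the highest
competing bid is `m`: the bidder wins exactly when `b ≥ m`, and then earns `v - b`. -/
def reward (b v m : I) : ℝ :=
  if m ≤ b then (v : ℝ) - (b : ℝ) else 0

/-- The comparator class: increasing 1-Lipschitz maps from private values to bids. -/
def Oracle : Type :=
  {a : I → I // Monotone a ∧ LipschitzWith 1 a}

/-- What the bidder has seen when she bids in round `t` (rounds are numbered from `0`):
the triples `(v_s, h_s, σ_s)` of the rounds `s ≤ t`, and the highest competing bids `m_s` of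
the rounds `s < t`. -/
abbrev Observation (t : ℕ) : Type :=
  (Fin (t + 1) → I × I × ℝ) × (Fin t → I)

namespace Observation

/-- The private value of the current round. -/
def value {t : ℕ} (o : Observation t) : I := (o.1 (Fin.last t)).1

/-- The hint of the current round. -/
def hint {t : ℕ} (o : Observation t) : I := (o.1 (Fin.last t)).2.1

/-- The accuracy `σ_t` revealed in the current round. -/
def accuracy {t : ℕ} (o : Observation t) : ℝ := (o.1 (Fin.last t)).2.2

end Observation

/-- A randomized bidding policy for `T` rounds: in every round, and for every possible
observation, a probability distribution of the bid, concentrated on `[0, v_t]`. -/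
structure Policy (T : ℕ) where
  bid : ∀ t : Fin T, Kernel (Observation t) I
  isMarkov : ∀ t, IsMarkovKernel (bid t)
  bid_le_value : ∀ (t : Fin T) (o : Observation t), ∀ᵐ b ∂(bid t o), b ≤ o.value

/-- An environment with horizon `T`, hints of order `q` and total error `L`: private values
`v_t`, accuracies `σ_t ≥ 0` (the field `acc`) with `∑ σ_t = L`, and an arbitrary joint law of the sequence of
pairs `(m_t, h_t)` of highest competing bids and hints, with `E |h_t - m_t|^q ≤ σ_t^q`. -/
structure Environment (T : ℕ) (q L : ℝ) where
  v : Fin T → I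
  acc : Fin T → ℝ
  acc_nonneg : ∀ t, 0 ≤ acc t
  sum_acc : ∑ t, acc t = L
  law : Measure (Fin T → I × I)
  isProbability : IsProbabilityMeasure law
  hint_error : ∀ t, ∫ x, |((x t).2 : ℝ) - ((x t).1 : ℝ)| ^ q ∂law ≤ acc t ^ q

/-- The observation of the bidder in round `t`, if the competing bids and hints are `x`. -/
def Environment.observation {T : ℕ} {q L : ℝ} (E : Environment T q L)
    (x : Fin T → I × I) (t : Fin T) : Observation t :=
  (fun s => (E.v (s.castLE t.isLt), (x (s.castLE t.isLt)).2, E.acc (s.castLE t.isLt)),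
   fun s => (x (s.castLE t.isLt.le)).1)

/-- Expected regret of a policy in an environment: the expected cumulative reward of the best
oracle in hindsight minus the expected cumulative reward of the policy. The expectations are
over the competing bids, the hints and the randomization of the policy. -/
def regret {T : ℕ} {q L : ℝ} (π : Policy T) (E : Environment T q L) : ℝ :=
  (∫ x, (⨆ a : Oracle, ∑ t, reward (a.1 (E.v t)) (E.v t) (x t).1) ∂E.law)
    - ∑ t, ∫ x, (∫ b, reward b (E.v t) (x t).1 ∂(π.bid t (E.observation x t))) ∂E.law

/-- Worst-case regret of a policy (all regrets are in `[-T, T]`). -/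
def worstRegret {T : ℕ} (q L : ℝ) (π : Policy T) : ℝ :=
  ⨆ E : Environment T q L, regret π E

/-- The minimax regret. -/
def minimaxRegret (T : ℕ) (q L : ℝ) : ℝ :=
  ⨅ π : Policy T, worstRegret q L π

/-- The policy ignores the hints: its bid depends only on the private values so far and on the
past competing bids. -/
def Policy.IgnoresHints {T : ℕ} (π : Policy T) : Prop :=
  ∀ (t : Fin T) (o o' : Observation t),
    (∀ s, (o.1 s).1 = (o'.1 s).1) → o.2 = o'.2 → π.bid t o = π.bid t o'

/-- The bid `min {v_t, h_t + σ_t ^ (q / (q + 1))}` (in `[0, 1]`). -/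
def hintBid (q : ℝ) {t : ℕ} (o : Observation t) : I :=
  min o.value
    (Set.projIcc (0 : ℝ) 1 zero_le_one ((o.hint : ℝ) + o.accuracy ^ (q / (q + 1))))

theorem measurable_hintBid (q : ℝ) (t : ℕ) :
    Measurable (hintBid q : Observation t → I) := by
  have h1 : Measurable (fun o : Observation t => o.1 (Fin.last t)) :=
    (measurable_pi_apply _).comp measurable_fst
  have hv : Measurable (fun o : Observation t => o.value) := measurable_fst.comp h1
  have hh : Measurable (fun o : Observation t => (o.hint : ℝ)) :=
    measurable_subtype_coe.comp (measurable_fst.comp (measurable_snd.comp h1))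
  have hs : Measurable (fun o : Observation t => o.accuracy) :=
    measurable_snd.comp (measurable_snd.comp h1)
  exact hv.min (continuous_projIcc.measurable.comp (hh.add (hs.pow_const _)))

/-- The policy that only bids the hint, with the safety margin `σ_t ^ (q / (q + 1))`, and never
learns from the past. -/
def hintPolicy (T : ℕ) (q : ℝ) : Policy T where
  bid t := Kernel.deterministic (hintBid q) (measurable_hintBid q t)
  isMarkov _ := inferInstance
  bid_le_value t o := by
    rw [Kernel.deterministic_apply, ae_dirac_iff measurableSet_Iic]
    exact min_le_left _ _

/-- The rate attained by bidding the hint. -/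
def hintRate (T : ℕ) (q L : ℝ) : ℝ :=
  (T : ℝ) ^ (1 / (q + 1)) * L ^ (q / (q + 1))

end FirstPriceAuction

end

/-! Upper bound by the hint. With margin `s = σ ^ (q / (q + 1))`, either the hint is off by at most
`s`, and bidding `h + s` wins while overpaying at most `2 * s`, or it is off by more, which by
Markov has probability at most `σ ^ q / s ^ q = s`. Each round costs at most `3 * s`, even against
the bid `m` itself, and Jensen sums this to `3 * hintRate` (`worstRegret_hintPolicy_le`).

Upper bound without hints. Values and bids are discretized dyadically by a tree of exponential
weights. A 1-Lipschitz comparator confines its bid to a window of length of order `2 ^ (-l)` on each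
of the `2 ^ l` value cells of level `l`. The reward is one-sided: raising a bid keeps every win and
costs at most the raise. So the top of the window is an expert that nobody beats by more than `Δ`,
of order `2 ^ (-l)`, and the second-order term of exponential weights is `η * Δ` per round rather
than `η` (`expWeight_regret`). The `2 ^ l` cells and the factor `2 ^ (-l)` in `Δ` cancel: every
level costs order `√T`, and there are about `log √T` levels (`tree_regret`,
`exists_policy_ignoresHints`).

Lower bound. In blocks of length about `1 / (8 * d)` the competing bid is `lo`, or `lo + d` with
probability at most `2 * d`, tuned so that no bid earns more than `v - lo - d` in expectation; the
hint is always `lo`. With probability at least `3 / 4` a block never sees the high bid, and the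
oracle then gains `d` per round. The values climb by `2 * d` from block to block, so the oracle may
choose independently in each block. Fitting the blocks into the value range forces `d ≲ 1 / √T`, and
the hint accuracy forces `d ^ (q + 1) ≲ (L / T) ^ q`; the regret `d * T` is then the stated minimum
(`exists_regret_ge`, `le_worstRegret`). -/

noncomputable section

namespace FirstPriceAuction

/-! ### Rewards, regret, and the upper bound for bidding the hint. -/

section HintPolicy

theorem reward_nonneg {b v : I} (h : b ≤ v) (m : I) : 0 ≤ reward b v m := by
  unfold reward
  split_ifs
  · exact sub_nonneg.2 h
  · exact le_rfl

theorem reward_le_max (b v m : I) : reward b v m ≤ max ((v : ℝ) - m) 0 := by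
  unfold reward
  split_ifs with h
  · have : (m : ℝ) ≤ b := h
    exact le_max_of_le_left (by linarith)
  · exact le_max_right _ _

theorem reward_le_one (b v m : I) : reward b v m ≤ 1 := by
  refine (reward_le_max b v m).trans (max_le ?_ zero_le_one)
  linarith [v.2.2, m.2.1]

theorem norm_reward_le_one (b v m : I) : ‖reward b v m‖ ≤ 1 := by
  rw [Real.norm_eq_abs, abs_le]
  refine ⟨?_, reward_le_one b v m⟩
  unfold reward
  split_ifs
  · linarith [v.2.1, b.2.2]
  · norm_num

/-- Raising the bid costs at most the raise. -/
theorem reward_le_add_sub {b b' v : I} (h : b ≤ b') (h' : b' ≤ v) (m : I) :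
    reward b v m ≤ reward b' v m + ((b' : ℝ) - b) := by
  have hb : (b : ℝ) ≤ b' := h
  by_cases hm : m ≤ b
  · simp [reward, hm, hm.trans h]
  · have := reward_nonneg h' m
    simp only [reward, hm, if_false] at this ⊢
    linarith

/-- Bidding above the value is never profitable. -/
theorem reward_le_reward_min (b v m : I) : reward b v m ≤ reward (min b v) v m := by
  rcases le_total b v with h | h
  · rw [min_eq_left h]
  · rw [min_eq_right h]
    have hb : (v : ℝ) ≤ b := h
    refine le_trans ?_ (reward_nonneg le_rfl m)
    unfold reward
    split_ifs
    · linarith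
    · exact le_rfl

theorem measurable_reward :
    Measurable (fun p : I × I × I => reward p.1 p.2.1 p.2.2) := by
  unfold reward
  refine Measurable.ite (measurableSet_le ?_ ?_) ?_ measurable_const
  · fun_prop
  · fun_prop
  · exact (measurable_subtype_coe.comp (by fun_prop)).sub
      (measurable_subtype_coe.comp measurable_fst)

theorem integrable_reward (μ : Measure I) [IsFiniteMeasure μ] (v m : I) :
    Integrable (fun b => reward b v m) μ := by
  refine Integrable.of_bound (C := 1) ?_ (.of_forall fun b => norm_reward_le_one b v m)
  exact (measurable_reward.comp (by fun_prop :
    Measurable fun b : I => (b, v, m))).aestronglyMeasurable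

instance : Nonempty Oracle := ⟨⟨id, monotone_id, LipschitzWith.id⟩⟩

theorem bddAbove_oracle {T : ℕ} (v m : Fin T → I) :
    BddAbove (Set.range fun a : Oracle => ∑ t, reward (a.1 (v t)) (v t) (m t)) := by
  refine ⟨∑ _t : Fin T, 1, ?_⟩
  rintro _ ⟨a, rfl⟩
  exact Finset.sum_le_sum fun t _ => reward_le_one _ _ _

theorem iSup_oracle_nonneg {T : ℕ} (v m : Fin T → I) :
    0 ≤ ⨆ a : Oracle, ∑ t, reward (a.1 (v t)) (v t) (m t) :=
  Real.iSup_nonneg' ⟨⟨id, monotone_id, LipschitzWith.id⟩,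
    Finset.sum_nonneg fun _ _ => reward_nonneg le_rfl _⟩

variable {T : ℕ} {q L : ℝ}

theorem Environment.measurable_observation (E : Environment T q L) (t : Fin T) :
    Measurable fun x => E.observation x t := by
  unfold Environment.observation
  fun_prop

/-- The conditional expected reward of a policy in round `t`. -/
def Policy.expReward (π : Policy T) (E : Environment T q L) (t : Fin T)
    (x : Fin T → I × I) : ℝ :=
  ∫ b, reward b (E.v t) (x t).1 ∂(π.bid t (E.observation x t))

theorem Policy.expReward_nonneg (π : Policy T) (E : Environment T q L) (t : Fin T)
    (x : Fin T → I × I) : 0 ≤ π.expReward E t x := by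
  refine integral_nonneg_of_ae ?_
  filter_upwards [π.bid_le_value t (E.observation x t)] with b hb
  exact reward_nonneg hb _

theorem Policy.norm_expReward_le (π : Policy T) (E : Environment T q L) (t : Fin T)
    (x : Fin T → I × I) : ‖π.expReward E t x‖ ≤ 1 := by
  have := π.isMarkov t
  refine (norm_integral_le_of_norm_le_const (C := 1)
    (.of_forall fun b => norm_reward_le_one _ _ _)).trans ?_
  simp

theorem Policy.measurable_expReward (π : Policy T) (E : Environment T q L) (t : Fin T) :
    Measurable (π.expReward E t) := by
  have := π.isMarkov t
  let κ : Kernel (Fin T → I × I) I := (π.bid t).comap _ (E.measurable_observation t)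
  have h : StronglyMeasurable fun p : (Fin T → I × I) × I => reward p.2 (E.v t) (p.1 t).1 :=
    (measurable_reward.comp (by fun_prop : Measurable
      fun p : (Fin T → I × I) × I => (p.2, E.v t, (p.1 t).1))).stronglyMeasurable
  exact (h.integral_kernel_prod_right' (κ := κ)).measurable

theorem Policy.integrable_expReward (π : Policy T) (E : Environment T q L) (t : Fin T) :
    Integrable (π.expReward E t) E.law := by
  have := E.isProbability
  exact Integrable.of_bound (C := 1) (π.measurable_expReward E t).aestronglyMeasurable
    (.of_forall fun x => π.norm_expReward_le E t x)

/-- A pointwise comparison with all oracles bounds the regret. -/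
theorem regret_le_integral (π : Policy T) (E : Environment T q L)
    {B : (Fin T → I × I) → ℝ} (hB : Integrable B E.law)
    (h : ∀ᵐ x ∂E.law, ∀ a : Oracle, ∑ t, reward (a.1 (E.v t)) (E.v t) (x t).1
      ≤ ∑ t, π.expReward E t x + B x) :
    regret π E ≤ ∫ x, B x ∂E.law := by
  have hi : Integrable (fun x => ∑ t, π.expReward E t x) E.law :=
    integrable_finsetSum _ fun t _ => π.integrable_expReward E t
  have key : ∫ x, (⨆ a : Oracle, ∑ t, reward (a.1 (E.v t)) (E.v t) (x t).1) ∂E.law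
      ≤ ∫ x, (∑ t, π.expReward E t x + B x) ∂E.law := by
    -- Measurability of the supremum over oracles is not needed: the left integrand is nonnegative,
    -- and its Bochner integral is `0` if it is not integrable.
    refine integral_mono_of_nonneg (.of_forall fun x => iSup_oracle_nonneg _ _)
      (hi.add hB) ?_
    filter_upwards [h] with x hx
    exact ciSup_le hx
  rw [integral_add hi hB, integral_finsetSum _ fun t _ => π.integrable_expReward E t] at key
  unfold regret
  simp only [Policy.expReward] at key
  linarith

/-- Supplies the boundedness without which the real supremum in `worstRegret` would not dominate
each regret. -/
theorem regret_le_horizon (π : Policy T) (E : Environment T q L) : regret π E ≤ T := by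
  have := E.isProbability
  have := regret_le_integral π E (B := fun _ => (T : ℝ)) (integrable_const _)
    (.of_forall fun x a => by
      have h1 : ∑ t, reward (a.1 (E.v t)) (E.v t) (x t).1 ≤ ∑ _t : Fin T, (1 : ℝ) :=
        Finset.sum_le_sum fun t _ => reward_le_one _ _ _
      have h2 := Finset.sum_nonneg fun t (_ : t ∈ Finset.univ) => π.expReward_nonneg E t x
      simp at h1
      linarith)
  simpa using this

theorem regret_le_worstRegret (π : Policy T) (E : Environment T q L) :
    regret π E ≤ worstRegret q L π :=
  le_ciSup (f := fun E => regret π E)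
    ⟨T, by rintro _ ⟨E, rfl⟩; exact regret_le_horizon π E⟩ E

/-! ### Bidding the hint -/

theorem expReward_hintPolicy (E : Environment T q L) (t : Fin T) (x : Fin T → I × I) :
    (hintPolicy T q).expReward E t x
      = reward (hintBid q (E.observation x t)) (E.v t) (x t).1 := by
  simp only [Policy.expReward, hintPolicy]
  rw [Kernel.deterministic_apply, integral_dirac]

/-- The raised hint lies in `[m, m + 2 * s]`, so it wins whenever winning is worthwhile and overpays
at most `2 * s`. -/
theorem max_sub_le_of_hint_close {v m h : I} {s : ℝ} (hs : |(h : ℝ) - m| ≤ s) :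
    max ((v : ℝ) - m) 0
      ≤ reward (min v (Set.projIcc (0 : ℝ) 1 zero_le_one ((h : ℝ) + s))) v m + 2 * s := by
  set b := Set.projIcc (0 : ℝ) 1 zero_le_one ((h : ℝ) + s) with hb
  have hs0 : 0 ≤ s := (abs_nonneg _).trans hs
  have h0 := reward_nonneg (min_le_left v b) m
  rcases le_total v m with hv | hv
  · have hv' : (v : ℝ) ≤ m := hv
    rw [max_eq_right (by linarith)]
    linarith
  · have hv' : (m : ℝ) ≤ v := hv
    rw [max_eq_left (by linarith)]
    have hbv : (b : ℝ) = min 1 ((h : ℝ) + s) := by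
      rw [hb, Set.coe_projIcc, max_eq_right]
      exact le_min zero_le_one (add_nonneg h.2.1 hs0)
    have hmb : m ≤ b := by
      rw [← Subtype.coe_le_coe, hbv]
      exact le_min m.2.2 (by linarith [(abs_le.1 hs).1])
    have hmin : ((min v b : I) : ℝ) ≤ (h : ℝ) + s :=
      (Subtype.coe_le_coe.2 (min_le_right v b)).trans (hbv.le.trans (min_le_right _ _))
    rw [reward, if_pos (le_min hv hmb)]
    linarith [(abs_le.1 hs).2]

/-- The loss is `2 * s` on the event that the hint is `s`-close; off it, the loss of at most `1` is
absorbed by the Markov term `|h - m| ^ q / s ^ q`. -/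
theorem hint_round_bound (hq : 1 ≤ q) (E : Environment T q L) (t : Fin T) :
    ∃ B : (Fin T → I × I) → ℝ, Integrable B E.law ∧
      ∫ x, B x ∂E.law ≤ 3 * E.acc t ^ (q / (q + 1)) ∧
      ∀ᵐ x ∂E.law, max ((E.v t : ℝ) - (x t).1) 0
        ≤ (hintPolicy T q).expReward E t x + B x := by
  have := E.isProbability
  set s := E.acc t ^ (q / (q + 1)) with hs
  have hmeas : Measurable fun x : Fin T → I × I => |((x t).2 : ℝ) - ((x t).1 : ℝ)| ^ q := by
    refine Measurable.pow_const (Measurable.abs (Measurable.sub ?_ ?_)) q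
    · exact measurable_subtype_coe.comp (by fun_prop)
    · exact measurable_subtype_coe.comp (by fun_prop)
  have hle1 : ∀ x : Fin T → I × I, |((x t).2 : ℝ) - ((x t).1 : ℝ)| ≤ 1 := fun x =>
    abs_le.2 ⟨by linarith [(x t).2.2.1, (x t).1.2.2], by linarith [(x t).2.2.2, (x t).1.2.1]⟩
  have hint : Integrable (fun x : Fin T → I × I => |((x t).2 : ℝ) - ((x t).1 : ℝ)| ^ q)
      E.law := by
    refine Integrable.of_bound (C := 1) hmeas.aestronglyMeasurable (.of_forall fun x => ?_)
    rw [Real.norm_of_nonneg (by positivity)]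
    exact Real.rpow_le_one (abs_nonneg _) (hle1 x) (by linarith)
  have hclose : ∀ x : Fin T → I × I, |((x t).2 : ℝ) - ((x t).1 : ℝ)| ≤ s →
      max ((E.v t : ℝ) - (x t).1) 0 ≤ (hintPolicy T q).expReward E t x + 2 * s := by
    intro x hx
    rw [expReward_hintPolicy]
    exact max_sub_le_of_hint_close hx
  -- Zero accuracy is separate because the Markov term divides by `s ^ q`; there the hint equals `m`
  -- almost surely.
  rcases (E.acc_nonneg t).eq_or_lt with h0 | h0
  · have hs0 : s = 0 := by
      rw [hs, ← h0, Real.zero_rpow (by positivity)]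
    refine ⟨fun _ => 0, integrable_zero _ _ _, by simp [hs0], ?_⟩
    have hz : ∫ x, |((x t).2 : ℝ) - ((x t).1 : ℝ)| ^ q ∂E.law = 0 := by
      refine le_antisymm ?_ (integral_nonneg fun x => by positivity)
      refine (E.hint_error t).trans ?_
      rw [← h0, Real.zero_rpow (by positivity)]
    rw [integral_eq_zero_iff_of_nonneg (fun x => by positivity) hint] at hz
    filter_upwards [hz] with x hx
    have := hclose x (by
      rw [hs0]
      have := (Real.rpow_eq_zero (abs_nonneg _) (by positivity)).1 hx
      exact this.le)
    simpa [hs0] using this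
  · have hs0 : 0 < s := Real.rpow_pos_of_pos h0 _
    refine ⟨fun x => 2 * s + |((x t).2 : ℝ) - ((x t).1 : ℝ)| ^ q / s ^ q,
      (integrable_const _).add (hint.div_const _), ?_, .of_forall fun x => ?_⟩
    · rw [integral_add (integrable_const _) (hint.div_const _), integral_div]
      -- The margin is chosen to balance both losses: `s * s ^ q = σ ^ q`.
      have : (∫ x, |((x t).2 : ℝ) - ((x t).1 : ℝ)| ^ q ∂E.law) / s ^ q ≤ s := by
        rw [div_le_iff₀ (by positivity)]
        refine (E.hint_error t).trans (le_of_eq ?_)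
        rw [hs, ← Real.rpow_mul h0.le, ← Real.rpow_add h0]
        congr 1
        field_simp
        ring
      simp only [integral_const, probReal_univ, one_smul]
      linarith
    · by_cases hx : |((x t).2 : ℝ) - ((x t).1 : ℝ)| ≤ s
      · have := hclose x hx
        have h2 : 0 ≤ |((x t).2 : ℝ) - ((x t).1 : ℝ)| ^ q / s ^ q := by positivity
        linarith
      · have h1 : max ((E.v t : ℝ) - (x t).1) 0 ≤ 1 :=
          max_le (by linarith [(E.v t).2.2, (x t).1.2.1]) zero_le_one
        have h2 := (hintPolicy T q).expReward_nonneg E t x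
        have h3 : 1 ≤ |((x t).2 : ℝ) - ((x t).1 : ℝ)| ^ q / s ^ q := by
          rw [one_le_div (by positivity)]
          exact Real.rpow_le_rpow hs0.le (not_le.1 hx).le (by linarith)
        linarith

/-- Jensen for the concave power `q / (q + 1)` with uniform weights `1 / T`: equal accuracies are
the worst case. -/
theorem sum_rpow_le_hintRate (hq : 1 ≤ q) (hT : 0 < T) (s : Fin T → ℝ) (hs : ∀ t, 0 ≤ s t) :
    ∑ t, s t ^ (q / (q + 1)) ≤ hintRate T q (∑ t, s t) := by
  have hT' : (0 : ℝ) < T := by exact_mod_cast hT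
  have hβ0 : 0 ≤ q / (q + 1) := by positivity
  have hβ1 : q / (q + 1) ≤ 1 := by rw [div_le_one (by positivity)]; linarith
  have h := (Real.concaveOn_rpow hβ0 hβ1).le_map_sum (t := Finset.univ)
    (w := fun _ : Fin T => (T : ℝ)⁻¹) (p := s) (fun _ _ => by positivity)
    (by simp [hT'.ne']) (fun t _ => hs t)
  simp only [smul_eq_mul, ← Finset.mul_sum] at h
  rw [inv_mul_le_iff₀ hT'] at h
  refine h.trans (le_of_eq ?_)
  have hS : 0 ≤ ∑ t, s t := Finset.sum_nonneg fun t _ => hs t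
  rw [Real.mul_rpow (by positivity) hS, hintRate, ← mul_assoc, Real.inv_rpow hT'.le,
    ← Real.rpow_neg hT'.le]
  congr 1
  nth_rw 1 [← Real.rpow_one (T : ℝ)]
  rw [← Real.rpow_add hT']
  congr 1
  field_simp
  ring

theorem worstRegret_hintPolicy_le (hT : 0 < T) (hL : 0 ≤ L) (hq : 1 ≤ q) :
    worstRegret q L (hintPolicy T q) ≤ 3 * hintRate T q L := by
  refine Real.iSup_le (fun E => ?_) (by unfold hintRate; positivity)
  choose B hB hB' hB'' using hint_round_bound hq E
  have h := regret_le_integral (hintPolicy T q) E (B := fun x => ∑ t, B t x)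
    (integrable_finsetSum _ fun t _ => hB t) (by
      filter_upwards [ae_all_iff.2 hB''] with x hx a
      rw [← Finset.sum_add_distrib]
      exact Finset.sum_le_sum fun t _ => (reward_le_max _ _ _).trans (hx t))
  rw [integral_finsetSum _ fun t _ => hB t] at h
  refine h.trans ((Finset.sum_le_sum fun t _ => hB' t).trans ?_)
  rw [← Finset.mul_sum]
  have := sum_rpow_le_hintRate hq hT E.acc E.acc_nonneg
  rw [E.sum_acc] at this
  linarith

end HintPolicy

/-! ### The lower bound, from a hard environment of independent coins. -/

section LowerBound

/-! ### Independent coin flips -/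

/-- The probability of the outcome `ω` of independent coins with biases `p`. -/
def coinWeight {T : ℕ} (p : Fin T → ℝ) (ω : Fin T → Bool) : ℝ :=
  ∏ t, if ω t then p t else 1 - p t

theorem coinWeight_nonneg {T : ℕ} {p : Fin T → ℝ} (h0 : ∀ t, 0 ≤ p t) (h1 : ∀ t, p t ≤ 1)
    (ω : Fin T → Bool) : 0 ≤ coinWeight p ω := by
  refine Finset.prod_nonneg fun t _ => ?_
  split_ifs
  · exact h0 t
  · exact sub_nonneg.2 (h1 t)

theorem sum_coinWeight {T : ℕ} (p : Fin T → ℝ) : ∑ ω, coinWeight p ω = 1 := by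
  have h := Finset.prod_univ_sum (fun _ : Fin T => (Finset.univ : Finset Bool))
    (fun t c => if c then p t else 1 - p t)
  rw [Fintype.piFinset_univ] at h
  unfold coinWeight
  rw [← h]
  simp

/-- Resampling one coin does not change expectations. -/
theorem sum_coinWeight_mul {T : ℕ} (p : Fin T → ℝ) (t : Fin T) (H : (Fin T → Bool) → ℝ) :
    ∑ ω, coinWeight p ω * H ω = ∑ ω, coinWeight p ω *
      ((1 - p t) * H (Function.update ω t false) + p t * H (Function.update ω t true)) := by
  let e := Equiv.funSplitAt t Bool
  have hupd : ∀ c c' ρ, Function.update (e.symm (c, ρ)) t c' = e.symm (c', ρ) := by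
    intro c c' ρ
    funext j
    by_cases hj : j = t
    · subst hj; simp [e, Equiv.funSplitAt, Equiv.piSplitAt]
    · simp [e, Equiv.funSplitAt, Equiv.piSplitAt, hj]
  have hw : ∀ c ρ, coinWeight p (e.symm (c, ρ)) = (if c then p t else 1 - p t) *
      ∏ j : {j // j ≠ t}, if ρ j then p j else 1 - p j := by
    intro c ρ
    unfold coinWeight
    rw [Fintype.prod_eq_mul_prod_subtype_ne _ t]
    congr 1
    · simp [e, Equiv.funSplitAt, Equiv.piSplitAt]
    · refine Finset.prod_congr rfl fun j _ => ?_
      simp [e, Equiv.funSplitAt, Equiv.piSplitAt, j.2]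
  rw [← e.symm.sum_comp, ← e.symm.sum_comp, Fintype.sum_prod_type, Fintype.sum_prod_type]
  simp only [hupd, hw, Fintype.sum_bool, if_true, Bool.false_eq_true, if_false]
  rw [← Finset.sum_add_distrib, ← Finset.sum_add_distrib]
  exact Finset.sum_congr rfl fun ρ _ => by ring

/-- Conditioning on all coins but the `t`-th: a bound on the average over that coin alone bounds the
expectation. -/
theorem sum_coinWeight_mul_le {T : ℕ} {p : Fin T → ℝ} (h0 : ∀ t, 0 ≤ p t) (h1 : ∀ t, p t ≤ 1)
    (t : Fin T) {H : (Fin T → Bool) → ℝ} {K : ℝ}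
    (h : ∀ ω, (1 - p t) * H (Function.update ω t false) + p t * H (Function.update ω t true) ≤ K) :
    ∑ ω, coinWeight p ω * H ω ≤ K := by
  rw [sum_coinWeight_mul p t]
  refine (Finset.sum_le_sum fun ω _ =>
    mul_le_mul_of_nonneg_left (h ω) (coinWeight_nonneg h0 h1 ω)).trans ?_
  rw [← Finset.sum_mul, sum_coinWeight, one_mul]

/-- The law of a function of independent coins. -/
def coinLaw {T : ℕ} {α : Type*} [MeasurableSpace α] (p : Fin T → ℝ)
    (X : (Fin T → Bool) → α) : Measure α :=
  ∑ ω, ENNReal.ofReal (coinWeight p ω) • Measure.dirac (X ω)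

theorem isProbabilityMeasure_coinLaw {T : ℕ} {α : Type*} [MeasurableSpace α] {p : Fin T → ℝ}
    (h0 : ∀ t, 0 ≤ p t) (h1 : ∀ t, p t ≤ 1) (X : (Fin T → Bool) → α) :
    IsProbabilityMeasure (coinLaw p X) := by
  constructor
  simp only [coinLaw, Measure.coe_finsetSum, Finset.sum_apply, Measure.smul_apply, smul_eq_mul,
    measure_univ, mul_one]
  rw [← ENNReal.ofReal_sum_of_nonneg fun ω _ => coinWeight_nonneg h0 h1 ω, sum_coinWeight,
    ENNReal.ofReal_one]

theorem integral_coinLaw {T : ℕ} {α : Type*} [MeasurableSpace α] [MeasurableSingletonClass α]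
    {p : Fin T → ℝ} (h0 : ∀ t, 0 ≤ p t) (h1 : ∀ t, p t ≤ 1) (X : (Fin T → Bool) → α)
    (f : α → ℝ) : ∫ x, f x ∂(coinLaw p X) = ∑ ω, coinWeight p ω * f (X ω) := by
  unfold coinLaw
  rw [integral_finsetSum_measure]
  · refine Finset.sum_congr rfl fun ω _ => ?_
    rw [integral_smul_measure, integral_dirac,
      ENNReal.toReal_ofReal (coinWeight_nonneg h0 h1 ω), smul_eq_mul]
  · intro ω _
    exact (integrable_dirac (by simp)).smul_measure ENNReal.ofReal_ne_top

/-! ### Oracles through prescribed points -/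

/-- A McShane extension: the maximum of the increasing 1-Lipschitz functions `x ↦ c t - max (v t -
x) 0`. The hypothesis says that the data are themselves increasing and 1-Lipschitz, so no term
exceeds `c s` at `v s`. -/
theorem exists_oracle_through {ι : Type*} [Fintype ι] (v c : ι → I)
    (h : ∀ s t, (c s : ℝ) ≤ c t + max ((v s : ℝ) - v t) 0) :
    ∃ a : Oracle, ∀ t, a.1 (v t) = c t := by
  rcases isEmpty_or_nonempty ι with hι | hι
  · exact ⟨⟨id, monotone_id, LipschitzWith.id⟩, fun t => (hι.false t).elim⟩
  have hne : (Finset.univ : Finset ι).Nonempty := Finset.univ_nonempty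
  let f : I → ℝ := fun x => Finset.univ.sup' hne fun t => (c t : ℝ) - max ((v t : ℝ) - x) 0
  have hmono : Monotone f := by
    intro x y hxy
    have hxy' : (x : ℝ) ≤ y := hxy
    refine Finset.sup'_le _ _ fun t _ => ?_
    refine le_trans ?_ (Finset.le_sup' (fun t => (c t : ℝ) - max ((v t : ℝ) - y) 0)
      (Finset.mem_univ t))
    gcongr
  have hlip : LipschitzWith 1 f := by
    refine LipschitzWith.of_le_add fun x y => ?_
    refine Finset.sup'_le _ _ fun t _ => ?_
    have h1 := Finset.le_sup' (fun t => (c t : ℝ) - max ((v t : ℝ) - y) 0) (Finset.mem_univ t)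
    have h2 : max ((v t : ℝ) - y) 0 ≤ max ((v t : ℝ) - x) 0 + dist x y := by
      rw [Subtype.dist_eq, Real.dist_eq]
      refine max_le ?_ (by positivity)
      linarith [le_max_left ((v t : ℝ) - x) 0, le_abs_self ((x : ℝ) - y)]
    change _ ≤ f y + _
    have h3 : (c t : ℝ) - max ((v t : ℝ) - y) 0 ≤ f y := h1
    linarith
  refine ⟨⟨fun x => Set.projIcc 0 1 zero_le_one (f x), (Set.monotone_projIcc _).comp hmono, ?_⟩,
    fun t => ?_⟩
  · have := (LipschitzWith.projIcc (zero_le_one (α := ℝ))).comp hlip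
    rwa [one_mul] at this
  · have hft : f (v t) = c t := by
      refine le_antisymm (Finset.sup'_le _ _ fun s _ => ?_) ?_
      · linarith [h s t]
      · have := Finset.le_sup' (fun s => (c s : ℝ) - max ((v s : ℝ) - v t) 0) (Finset.mem_univ t)
        simpa using this
    change Set.projIcc 0 1 zero_le_one (f (v t)) = c t
    rw [hft, Set.projIcc_val]

/-! ### The hard environment -/

variable {T : ℕ} {q : ℝ}

/-- Every bid earns at most `v - b₁` if the competing bid is `b₁` with probability
`(b₁ - b₀) / (v - b₀)`, and `b₀` otherwise. -/
theorem reward_mix_le {v b₀ b₁ : I} {p : ℝ} (h01 : b₀ ≤ b₁) (h1v : b₁ ≤ v) (hp1 : p ≤ 1)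
    (hp : ((v : ℝ) - b₀) * p = b₁ - b₀) (b : I) :
    (1 - p) * reward b v b₀ + p * reward b v b₁ ≤ v - b₁ := by
  have e01 : (b₀ : ℝ) ≤ b₁ := h01
  have e1v : (b₁ : ℝ) ≤ v := h1v
  unfold reward
  by_cases hb0 : b₀ ≤ b
  · have e0 : (b₀ : ℝ) ≤ b := hb0
    rw [if_pos hb0]
    split_ifs with hb1
    · have e1 : (b₁ : ℝ) ≤ b := hb1
      linarith
    -- A bid that beats only `b₀` earns at most `(1 - p) * (v - b₀)`, which is `v - b₁` by the
    -- choice of `p`.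
    · nlinarith
  · rw [if_neg hb0, if_neg fun h => hb0 (h01.trans h)]
    linarith

/-- Here `d` is the gap between the two competing bids and `n` the block length. `hnd` keeps the
chance of a high bid in a block below `1 / 4`, `hTd` keeps all values in `[0, 1]`, and `hσ` makes
the constant hint accurate enough. -/
theorem exists_regret_ge {n : ℕ} {d σ' L : ℝ} (hn : 0 < n) (hd : 0 < d) (hnd : n * d ≤ 1 / 8)
    (hd16 : d ≤ 1 / 16) (hTd : ∀ t : Fin T, 2 * d * ((t / n : ℕ) : ℝ) ≤ 1 / 4)
    (hσ0 : 0 ≤ σ') (hL : T * σ' = L) (hσ : 2 * d * d ^ q ≤ σ' ^ q) (hq : 1 ≤ q) (π : Policy T) :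
    ∃ E : Environment T q L, 3 / 4 * d * T ≤ regret π E := by
  let j : Fin T → ℝ := fun t => ((t / n : ℕ) : ℝ)
  have hj0 : ∀ t, 0 ≤ d * j t := fun t => by positivity
  have hj : ∀ t, d * j t ≤ 1 / 8 := fun t => by have := hTd t; simp only [j]; linarith
  let v : Fin T → I := fun t => ⟨1 / 2 + 2 * (d * j t), by linarith [hj0 t], by linarith [hj t]⟩
  let lo : Fin T → I := fun t => ⟨d * j t, hj0 t, by linarith [hj t]⟩
  let hi : Fin T → I := fun t => ⟨d * j t + d, by linarith [hj0 t], by linarith [hj t]⟩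
  let p : Fin T → ℝ := fun t => d / (1 / 2 + d * j t)
  have hden : ∀ t, 0 < 1 / 2 + d * j t := fun t => by linarith [hj0 t]
  have hp0 : ∀ t, 0 ≤ p t := fun t => by have := hden t; positivity
  have hp2 : ∀ t, p t ≤ 2 * d := fun t => by
    simp only [p]; rw [div_le_iff₀ (hden t)]; nlinarith [hj0 t]
  have hp1 : ∀ t, p t ≤ 1 := fun t => by linarith [hp2 t]
  -- The hint is `lo t` whatever the coin shows, so it reveals nothing about it.
  let X : (Fin T → Bool) → Fin T → I × I := fun ω t => (if ω t then hi t else lo t, lo t)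
  let E : Environment T q L :=
    { v := v
      acc := fun _ => σ'
      acc_nonneg := fun _ => hσ0
      sum_acc := by simpa using hL
      law := coinLaw p X
      isProbability := isProbabilityMeasure_coinLaw hp0 hp1 X
      hint_error := fun t => by
        rw [integral_coinLaw hp0 hp1]
        refine sum_coinWeight_mul_le hp0 hp1 t fun ω => ?_
        have h1 : |((lo t : I) : ℝ) - (hi t : I)| = d := by
          simp only [lo, hi]; rw [sub_add_cancel_left, abs_neg, abs_of_pos hd]
        simp only [X, Function.update_self, if_true, Bool.false_eq_true, if_false, sub_self,
          abs_zero, h1]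
        rw [Real.zero_rpow (by positivity), mul_zero, zero_add]
        refine le_trans ?_ hσ
        gcongr
        exact hp2 t }
  refine ⟨E, ?_⟩
  have hpolicy : ∀ t, ∫ x, π.expReward E t x ∂E.law ≤ (v t : ℝ) - hi t := by
    intro t
    have := π.isMarkov t
    rw [integral_coinLaw hp0 hp1]
    refine sum_coinWeight_mul_le hp0 hp1 t fun ω => ?_
    -- What is seen before bidding does not involve the `t`-th coin, so the bid is independent of it
    -- and `reward_mix_le` applies.
    have hobs : ∀ c, E.observation (X (Function.update ω t c)) t = E.observation (X ω) t := by
      intro c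
      refine Prod.ext rfl ?_
      funext s
      have hs : s.castLE t.isLt.le ≠ t := fun h => by
        have := congrArg Fin.val h
        simp at this
        omega
      simp [Environment.observation, X, Function.update_of_ne hs]
    simp only [Policy.expReward, hobs]
    rw [← integral_const_mul, ← integral_const_mul, ← integral_add
      ((integrable_reward _ _ _).const_mul _) ((integrable_reward _ _ _).const_mul _)]
    have hle : ∀ b : I, (1 - p t) * reward b (E.v t) (X (Function.update ω t false) t).1 +
        p t * reward b (E.v t) (X (Function.update ω t true) t).1 ≤ (v t : ℝ) - hi t := by
      intro b
      simp only [X, Function.update_self, if_true, Bool.false_eq_true, if_false]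
      refine reward_mix_le ?_ ?_ (hp1 t) ?_ b
      · exact Subtype.coe_le_coe.1 (by simp only [lo, hi]; linarith)
      · exact Subtype.coe_le_coe.1 (by simp only [E, v, hi]; linarith [hj0 t])
      · simp only [E, v, lo, hi, p]
        rw [show 1 / 2 + 2 * (d * j t) - d * j t = 1 / 2 + d * j t by ring,
          mul_div_cancel₀ _ (hden t).ne']
        ring
    refine (integral_mono (((integrable_reward _ _ _).const_mul _).add
      ((integrable_reward _ _ _).const_mul _)) (integrable_const _) hle).trans ?_
    simp
  let near : Fin T → Finset (Fin T) := fun t =>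
    Finset.univ.filter fun s => (s : ℕ) / n = (t : ℕ) / n
  have hnear : ∀ t, (near t).card ≤ n := by
    intro t
    calc (near t).card = ((near t).map Fin.valEmbedding).card := (Finset.card_map _).symm
      _ ≤ (Finset.Ico (n * (t / n)) (n * (t / n) + n)).card := by
        refine Finset.card_le_card fun k hk => ?_
        obtain ⟨s, hs, rfl⟩ := Finset.mem_map.1 hk
        have hs' : (s : ℕ) / n = t / n := (Finset.mem_filter.1 hs).2
        have h1 := Nat.div_add_mod (s : ℕ) n
        have h2 := Nat.mod_lt (s : ℕ) hn
        rw [hs'] at h1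
        simp only [Fin.valEmbedding_apply, Finset.mem_Ico]
        omega
      _ = n := by simp
  -- The number of high bids in the block dominates the indicator that there is one, so a union
  -- bound will suffice later.
  have horacle : ∀ ω, ∑ t, ((v t : ℝ) - hi t + d * (1 - ∑ s ∈ near t, if ω s then 1 else 0))
      ≤ ⨆ a : Oracle, ∑ t, reward (a.1 (E.v t)) (E.v t) (X ω t).1 := by
    intro ω
    classical
    -- `B k` says that block `k` contains a high bid; the oracle then bids `hi` throughout the
    -- block, and otherwise `lo`.
    let B : ℕ → Prop := fun k => ∃ s : Fin T, (s : ℕ) / n = k ∧ ω s = true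
    let c : Fin T → I := fun t => if B (t / n) then hi t else lo t
    have hc : ∀ t, (c t : ℝ) = d * j t + if B (t / n) then d else 0 := by
      intro t
      simp only [c]
      split_ifs <;> simp [hi, lo]
    obtain ⟨a, ha⟩ := exists_oracle_through v c (by
      intro s t
      rw [hc, hc]
      have hv : (v s : ℝ) - v t = 2 * (d * (j s - j t)) := by simp only [v]; ring
      rw [hv]
      -- From one block to the next the base bid rises by `d` and the value by `2 * d`, while the
      -- choice between `lo` and `hi` shifts the bid by at most `d`; so every pattern of choices is
      -- increasing and 1-Lipschitz.
      rcases lt_trichotomy ((s : ℕ) / n) (t / n) with h | h | h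
      · have h' : j s + 1 ≤ j t := by
          simp only [j]; exact_mod_cast Nat.succ_le_of_lt h
        have h1 := le_max_right (2 * (d * (j s - j t))) 0
        have h2 : d * (j s + 1) ≤ d * j t := by gcongr
        have h3 : (if B ((s : ℕ) / n) then d else 0) ≤ d := by split_ifs <;> linarith
        have h4 : 0 ≤ (if B ((t : ℕ) / n) then d else 0) := by split_ifs <;> linarith
        linarith
      · have h' : j s = j t := by simp only [j, h]
        rw [h, h']
        simp
      · have h' : j t + 1 ≤ j s := by
          simp only [j]; exact_mod_cast Nat.succ_le_of_lt h
        have h1 := le_max_left (2 * (d * (j s - j t))) 0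
        have h2 : d * (j t + 1) ≤ d * j s := by gcongr
        have h3 : (if B ((s : ℕ) / n) then d else 0) ≤ d := by split_ifs <;> linarith
        have h4 : 0 ≤ (if B ((t : ℕ) / n) then d else 0) := by split_ifs <;> linarith
        linarith)
    refine le_trans (Finset.sum_le_sum fun t _ => ?_) (le_ciSup (bddAbove_oracle _ _) a)
    change _ ≤ reward (a.1 (v t)) (v t) (if ω t then hi t else lo t)
    rw [ha]
    have hlohi : lo t ≤ hi t := Subtype.coe_le_coe.1 (by simp only [lo, hi]; linarith)
    by_cases hB : B (t / n)
    · have hct : c t = hi t := if_pos hB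
      rw [hct, reward, if_pos (by split_ifs <;> [exact le_rfl; exact hlohi])]
      obtain ⟨s, hs, hωs⟩ := hB
      have : (1 : ℝ) ≤ ∑ s ∈ near t, if ω s then 1 else 0 := by
        have := Finset.single_le_sum (f := fun s => if ω s then (1 : ℝ) else 0)
          (fun s _ => by positivity)
          (Finset.mem_filter.2 ⟨Finset.mem_univ s, hs⟩ : s ∈ near t)
        simpa [hωs] using this
      nlinarith
    · have hct : c t = lo t := if_neg hB
      have hωt : ¬ ω t = true := fun h => hB ⟨t, rfl, h⟩
      rw [hct, if_neg hωt, reward, if_pos le_rfl]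
      have : (0 : ℝ) ≤ ∑ s ∈ near t, if ω s then 1 else 0 :=
        Finset.sum_nonneg fun s _ => by positivity
      simp only [hi, lo]
      nlinarith
  have hcount : ∀ t, ∑ ω, coinWeight p ω * ∑ s ∈ near t, (if ω s then (1 : ℝ) else 0)
      ≤ 1 / 4 := by
    intro t
    simp only [Finset.mul_sum]
    rw [Finset.sum_comm]
    have h1 : ∀ s ∈ near t, ∑ ω, coinWeight p ω * (if ω s then (1 : ℝ) else 0) ≤ 2 * d :=
      fun s _ => sum_coinWeight_mul_le hp0 hp1 s fun ω => by simpa using hp2 s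
    refine (Finset.sum_le_card_nsmul _ _ _ h1).trans ?_
    rw [nsmul_eq_mul]
    have : ((near t).card : ℝ) ≤ n := by exact_mod_cast hnear t
    nlinarith
  unfold regret
  rw [show E.law = coinLaw p X from rfl, integral_coinLaw hp0 hp1]
  have hO : ∑ t, ((v t : ℝ) - hi t) + 3 / 4 * d * T
      ≤ ∑ ω, coinWeight p ω *
        ⨆ a : Oracle, ∑ t, reward (a.1 (E.v t)) (E.v t) (X ω t).1 := by
    refine le_trans ?_ (Finset.sum_le_sum fun ω _ =>
      mul_le_mul_of_nonneg_left (horacle ω) (coinWeight_nonneg hp0 hp1 ω))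
    simp only [Finset.mul_sum (s := (Finset.univ : Finset (Fin T)))]
    rw [Finset.sum_comm]
    have : ∑ t : Fin T, ((v t : ℝ) - hi t + 3 / 4 * d) = ∑ t, ((v t : ℝ) - hi t) + 3 / 4 * d * T := by
      rw [Finset.sum_add_distrib]
      simp
      ring
    rw [← this]
    refine Finset.sum_le_sum fun t _ => ?_
    have e : ∀ ω, coinWeight p ω *
        ((v t : ℝ) - hi t + d * (1 - ∑ s ∈ near t, if ω s then 1 else 0))
        = coinWeight p ω * ((v t : ℝ) - hi t + d)
          - d * (coinWeight p ω * ∑ s ∈ near t, if ω s then (1 : ℝ) else 0) := fun ω => by ring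
    simp only [e]
    rw [Finset.sum_sub_distrib, ← Finset.sum_mul, ← Finset.mul_sum, sum_coinWeight]
    nlinarith [hcount t]
  have hP : ∑ t, ∫ x, π.expReward E t x ∂(coinLaw p X) ≤ ∑ t, ((v t : ℝ) - hi t) :=
    Finset.sum_le_sum fun t _ => hpolicy t
  simp only [Policy.expReward] at hP
  linarith

/-- The lower bound for every policy. -/
theorem le_worstRegret {L : ℝ} (hL : 1 ≤ L) (hLT : L ≤ T) (hq : 1 ≤ q) (π : Policy T) :
    3 / 64 * min (hintRate T q L) (√(T : ℝ)) ≤ worstRegret q L π := by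
  have hT : (1 : ℝ) ≤ T := hL.trans hLT
  have hT0 : (0 : ℝ) < T := by linarith
  have hL0 : 0 < L := by linarith
  have hs0 : 0 < √(T : ℝ) := Real.sqrt_pos.2 hT0
  have hss : √(T : ℝ) * √(T : ℝ) = T := Real.mul_self_sqrt hT0.le
  have hs1 : 1 ≤ √(T : ℝ) := Real.one_le_sqrt.2 hT
  set r := min (hintRate T q L) (√(T : ℝ)) with hr
  have hrate : hintRate T q L = T * (L / T) ^ (q / (q + 1)) := by
    have h1 : 1 / (q + 1) = 1 + -(q / (q + 1)) := by field_simp; ring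
    rw [hintRate, Real.div_rpow hL0.le hT0.le, h1, Real.rpow_add hT0, Real.rpow_one,
      Real.rpow_neg hT0.le]
    ring
  have hr0 : 0 < r := lt_min (by rw [hrate]; positivity) hs0
  -- The two bounds on `r` give the two constraints: `r ≤ √T` lets the blocks fit, and `r ≤
  -- hintRate` gives the hint accuracy. The resulting regret is `3 / 4 * d * T = 3 / 64 * r`.
  set d := r / (16 * T) with hdef
  have hd : 0 < d := by positivity
  have hdT : d * T = r / 16 := by rw [hdef]; field_simp
  have hds : d * √(T : ℝ) ≤ 1 / 16 := by
    have h1 : r ≤ √(T : ℝ) := min_le_right _ _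
    have h2 : d * √(T : ℝ) * √(T : ℝ) ≤ 1 / 16 * √(T : ℝ) := by
      rw [mul_assoc, hss, hdT]; linarith
    exact le_of_mul_le_mul_right h2 hs0
  have hd16 : d ≤ 1 / 16 := by nlinarith
  -- The longest blocks with `n * d ≤ 1 / 8`; since `d ≤ 1 / 16`, also `n * d ≥ 1 / 16`, which
  -- bounds the number of blocks by order `T * d`.
  set n := ⌊1 / (8 * d)⌋₊ with hn
  have hn1 : (n : ℝ) ≤ 1 / (8 * d) := Nat.floor_le (by positivity)
  have hn2 : 1 / (8 * d) < n + 1 := Nat.lt_floor_add_one _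
  have hn8 : (n : ℝ) * d ≤ 1 / 8 := by
    rw [le_div_iff₀ (by positivity)] at hn1; linarith
  have hn8' : 1 / 8 < (n + 1) * d := by
    rw [div_lt_iff₀ (by positivity)] at hn2; linarith
  have hn16 : 1 / 16 ≤ n * d := by linarith
  have hnpos : 0 < n := by
    rcases Nat.eq_zero_or_pos n with h | h
    · rw [h] at hn16; norm_num at hn16
    · exact h
  have hdσ : 2 * d * d ^ q ≤ (L / T) ^ q := by
    have hβ : 0 < (L / T) ^ (q / (q + 1)) := by positivity
    have h1 : d ≤ (L / T) ^ (q / (q + 1)) / 16 := by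
      have h1 : d * T ≤ (L / T) ^ (q / (q + 1)) / 16 * T := by
        have : r ≤ T * (L / T) ^ (q / (q + 1)) := hrate ▸ min_le_left _ _
        rw [hdT]; linarith
      exact le_of_mul_le_mul_right h1 hT0
    have h2 : d ^ q ≤ ((L / T) ^ (q / (q + 1))) ^ q :=
      Real.rpow_le_rpow hd.le (by linarith) (by linarith)
    calc 2 * d * d ^ q ≤ (L / T) ^ (q / (q + 1)) * ((L / T) ^ (q / (q + 1))) ^ q := by
          gcongr; linarith
      _ = (L / T) ^ q := by
          rw [← Real.rpow_mul (by positivity), ← Real.rpow_add (by positivity)]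
          congr 1
          field_simp
          ring
  obtain ⟨E, hE⟩ := exists_regret_ge hnpos hd hn8 hd16 (fun t => by
    have h1 : ((t / n : ℕ) : ℝ) ≤ (t : ℝ) / n := Nat.cast_div_le
    have h2 : ((t : ℕ) : ℝ) ≤ T := by exact_mod_cast t.isLt.le
    have hn0 : (0 : ℝ) < n := by exact_mod_cast hnpos
    have h3 : ((t / n : ℕ) : ℝ) * n ≤ T := by
      rw [le_div_iff₀ hn0] at h1; linarith
    have h4 : ((t / n : ℕ) : ℝ) ≤ 16 * (T * d) := by
      have : ((t / n : ℕ) : ℝ) * 1 ≤ ((t / n : ℕ) : ℝ) * (16 * (n * d)) := by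
        gcongr; linarith
      nlinarith
    have h5 : d * ((t / n : ℕ) : ℝ) ≤ 16 * (d * √(T : ℝ)) * (d * √(T : ℝ)) := by
      calc d * ((t / n : ℕ) : ℝ) ≤ d * (16 * (T * d)) := by gcongr
        _ = 16 * (d * √(T : ℝ)) * (d * √(T : ℝ)) := by nth_rw 1 [← hss]; ring
    have h6 : 0 ≤ d * √(T : ℝ) := by positivity
    nlinarith) (by positivity) (mul_div_cancel₀ L hT0.ne') hdσ hq π
  refine le_trans ?_ (hE.trans (regret_le_worstRegret π E))
  rw [mul_assoc, hdT]
  linarith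

end LowerBound

/-! ### Exponential weights with a good expert, and their dyadic tree. -/

section Tree

/-! ### Exponential weights with a good expert -/

section ExpWeights

variable {ι : Type*} (η : ℝ) (A : ℕ → Prop) [DecidablePred A] (y : ι → ℕ → ℝ)

/-- The cumulative reward of expert `i` before round `t`, over the active rounds. -/
def cumReward (i : ι) (t : ℕ) : ℝ := ∑ s ∈ Finset.range t, if A s then y i s else 0

theorem cumReward_succ (i : ι) (t : ℕ) :
    cumReward A y i (t + 1) = cumReward A y i t + if A t then y i t else 0 :=
  Finset.sum_range_succ _ _

variable [Fintype ι]

/-- The exponential weight of expert `i` in round `t`. -/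
def expWeight (i : ι) (t : ℕ) : ℝ :=
  Real.exp (η * cumReward A y i t) / ∑ j, Real.exp (η * cumReward A y j t)

theorem expWeight_nonneg (i : ι) (t : ℕ) : 0 ≤ expWeight η A y i t := by
  unfold expWeight
  positivity

theorem sum_expWeight [Nonempty ι] (t : ℕ) : ∑ i, expWeight η A y i t = 1 := by
  unfold expWeight
  rw [← Finset.sum_div, div_self]
  exact (Finset.sum_pos (fun i _ => Real.exp_pos _) Finset.univ_nonempty).ne'

variable {η A y}

/-- The exponential moment of rewards none of which exceeds that of expert `o` by more
than `Δ`. -/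
theorem sum_mul_exp_le {p x : ι → ℝ} {o : ι} {Δ : ℝ} (hη0 : 0 < η) (hη1 : η ≤ 1)
    (hp : ∀ i, 0 ≤ p i) (hp1 : ∑ i, p i = 1) (hx0 : ∀ i, 0 ≤ x i) (hx1 : ∀ i, x i ≤ 1)
    (hΔ : ∀ i, x i ≤ x o + Δ) :
    ∑ i, p i * Real.exp (η * x i)
      ≤ Real.exp (η * ∑ i, p i * x i + η ^ 2 * (2 * Δ + (x o - ∑ i, p i * x i))) := by
  have hΔ0 : 0 ≤ Δ := by linarith [hΔ o]
  have h1 : ∀ i, Real.exp (η * x i) ≤ Real.exp (η * x o) *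
      (1 + η * (x i - x o) + η ^ 2 * (2 * Δ + (x o - x i))) := by
    intro i
    have hz : |x i - x o| ≤ 1 :=
      abs_le.2 ⟨by linarith [hx0 i, hx1 o], by linarith [hx0 o, hx1 i]⟩
    have hηz : |η * (x i - x o)| ≤ 1 := by
      rw [abs_mul, abs_of_pos hη0]
      exact mul_le_one₀ hη1 (abs_nonneg _) hz
    have h2 := (abs_le.1 (Real.abs_exp_sub_one_sub_id_le hηz)).2
    -- If `x i ≥ x o` then `2 * (x i - x o) ≤ 2 * Δ`; otherwise the square is at most `x o - x i`.
    -- So the second moment is paid by `Δ` and by the regret against `o`.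
    have h3 : (x i - x o) ^ 2 ≤ 2 * Δ + (x o - x i) := by
      have h4 : (x i - x o) ^ 2 ≤ |x i - x o| := by
        rw [← sq_abs]; nlinarith [abs_nonneg (x i - x o)]
      refine h4.trans (abs_le.2 ⟨by linarith, by linarith [hΔ i]⟩)
    have h5 : η * x i = η * x o + η * (x i - x o) := by ring
    rw [h5, Real.exp_add]
    refine mul_le_mul_of_nonneg_left ?_ (Real.exp_pos _).le
    have h6 : (η * (x i - x o)) ^ 2 ≤ η ^ 2 * (2 * Δ + (x o - x i)) := by
      rw [mul_pow]; gcongr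
    linarith
  set m := ∑ i, p i * x i with hm
  have e : ∑ i, p i * (Real.exp (η * x o) *
      (1 + η * (x i - x o) + η ^ 2 * (2 * Δ + (x o - x i))))
      = Real.exp (η * x o) * (1 + (η * (m - x o) + η ^ 2 * (2 * Δ + (x o - m)))) := by
    have e1 : ∀ i, p i * (Real.exp (η * x o) *
        (1 + η * (x i - x o) + η ^ 2 * (2 * Δ + (x o - x i))))
        = p i * (Real.exp (η * x o) * (1 - η * x o + η ^ 2 * (2 * Δ + x o)))
          + (p i * x i) * (Real.exp (η * x o) * (η - η ^ 2)) := fun i => by ring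
    simp only [e1]
    rw [Finset.sum_add_distrib, ← Finset.sum_mul, ← Finset.sum_mul, hp1, ← hm]
    ring
  refine (Finset.sum_le_sum fun i _ => mul_le_mul_of_nonneg_left (h1 i) (hp i)).trans ?_
  rw [e]
  have h7 : η * m + η ^ 2 * (2 * Δ + (x o - m))
      = η * x o + (η * (m - x o) + η ^ 2 * (2 * Δ + (x o - m))) := by ring
  rw [h7, Real.exp_add]
  refine mul_le_mul_of_nonneg_left ?_ (Real.exp_pos _).le
  linarith [Real.add_one_le_exp (η * (m - x o) + η ^ 2 * (2 * Δ + (x o - m)))]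

/-- The potential argument: an active round multiplies the total weight by the exponential moment of
`sum_mul_exp_le`, an inactive one leaves it unchanged. -/
theorem sum_exp_cumReward_le [Nonempty ι] {o : ι} {Δ : ℝ} (hη0 : 0 < η) (hη1 : η ≤ 1)
    (hy0 : ∀ i s, 0 ≤ y i s) (hy1 : ∀ i s, y i s ≤ 1) (hΔ : ∀ i s, y i s ≤ y o s + Δ) (n : ℕ) :
    ∑ i, Real.exp (η * cumReward A y i n) ≤ Fintype.card ι *
      Real.exp (∑ s ∈ Finset.range n, if A s then
        η * ∑ i, expWeight η A y i s * y i s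
          + η ^ 2 * (2 * Δ + (y o s - ∑ i, expWeight η A y i s * y i s)) else 0) := by
  induction n with
  | zero => simp [cumReward]
  | succ n ih =>
    rw [Finset.sum_range_succ]
    by_cases hA : A n
    · have hpos : 0 < ∑ i, Real.exp (η * cumReward A y i n) :=
        Finset.sum_pos (fun i _ => Real.exp_pos _) Finset.univ_nonempty
      have h := sum_mul_exp_le hη0 hη1 (fun i => expWeight_nonneg η A y i n)
        (sum_expWeight η A y n) (fun i => hy0 i n) (fun i => hy1 i n) (fun i => hΔ i n)
      have e : ∑ i, Real.exp (η * cumReward A y i (n + 1))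
          = (∑ i, Real.exp (η * cumReward A y i n)) *
            ∑ i, expWeight η A y i n * Real.exp (η * y i n) := by
        rw [Finset.mul_sum]
        refine Finset.sum_congr rfl fun i _ => ?_
        rw [cumReward_succ, if_pos hA, mul_add, Real.exp_add, expWeight]
        field_simp
      rw [e, if_pos hA, Real.exp_add, ← mul_assoc]
      exact mul_le_mul ih h (Finset.sum_nonneg fun i _ =>
        mul_nonneg (expWeight_nonneg η A y i n) (Real.exp_pos _).le) (by positivity)
    · simp only [cumReward_succ, if_neg hA, add_zero]
      exact ih

/-- If no expert ever beats expert `o` by more than `Δ`, exponential weights have small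
regret. -/
theorem expWeight_regret [Nonempty ι] {o : ι} {Δ : ℝ} (hη0 : 0 < η) (hη1 : η ≤ 1 / 2)
    (hy0 : ∀ i s, 0 ≤ y i s) (hy1 : ∀ i s, y i s ≤ 1) (hΔ : ∀ i s, y i s ≤ y o s + Δ)
    (i : ι) (n : ℕ) :
    ∑ t ∈ Finset.range n, (if A t then y i t - ∑ j, expWeight η A y j t * y j t else 0)
      ≤ 2 * (Real.log (Fintype.card ι) / η
        + 2 * η * Δ * ∑ t ∈ Finset.range n, if A t then 1 else 0) := by
  have hΔ0 : 0 ≤ Δ := by linarith [hΔ o 0]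
  set N : ℝ := ∑ t ∈ Finset.range n, if A t then 1 else 0 with hN
  have hN0 : 0 ≤ N := Finset.sum_nonneg fun t _ => by positivity
  set M : ℝ := ∑ t ∈ Finset.range n,
    if A t then ∑ j, expWeight η A y j t * y j t else 0 with hM
  have hcard : (0 : ℝ) < Fintype.card ι := by exact_mod_cast Fintype.card_pos
  have hcard1 : (1 : ℝ) ≤ Fintype.card ι := by exact_mod_cast Fintype.card_pos
  set Q := Real.log (Fintype.card ι) / η + 2 * η * Δ * N with hQ
  have hQ0 : 0 ≤ Q := by have := Real.log_nonneg hcard1; positivity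
  have hdiff : ∀ i, ∑ t ∈ Finset.range n,
      (if A t then y i t - ∑ j, expWeight η A y j t * y j t else 0)
      = cumReward A y i n - M := by
    intro i
    rw [cumReward, hM, ← Finset.sum_sub_distrib]
    refine Finset.sum_congr rfl fun t _ => ?_
    split_ifs <;> simp
  have hsum : (∑ s ∈ Finset.range n, if A s then
        η * ∑ i, expWeight η A y i s * y i s
          + η ^ 2 * (2 * Δ + (y o s - ∑ i, expWeight η A y i s * y i s)) else 0)
      = η * M + η ^ 2 * (2 * Δ * N + (cumReward A y o n - M)) := by
    rw [cumReward, hM, hN, ← Finset.sum_sub_distrib, Finset.mul_sum, Finset.mul_sum,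
      ← Finset.sum_add_distrib, Finset.mul_sum, ← Finset.sum_add_distrib]
    refine Finset.sum_congr rfl fun t _ => ?_
    split_ifs <;> simp
  -- A self-bounding inequality: with `i = o` and `η ≤ 1 / 2` it bounds the regret against `o` by `2
  -- * Q`; inserting this gives `2 * Q` for every `i`.
  have key : ∀ i, cumReward A y i n - M ≤ Q + η * (cumReward A y o n - M) := by
    intro i
    have h1 := sum_exp_cumReward_le (A := A) hη0 (by linarith) hy0 hy1 hΔ n
    have h2 : Real.exp (η * cumReward A y i n) ≤ _ :=
      (Finset.single_le_sum (f := fun i => Real.exp (η * cumReward A y i n))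
        (fun i _ => (Real.exp_pos _).le) (Finset.mem_univ i)).trans h1
    rw [hsum] at h2
    have h3 := Real.log_le_log (Real.exp_pos _) h2
    rw [Real.log_exp, Real.log_mul hcard.ne' (Real.exp_pos _).ne', Real.log_exp] at h3
    have h4 : η * (cumReward A y i n - M) ≤ η * (Q + η * (cumReward A y o n - M)) := by
      have : η * Q = Real.log (Fintype.card ι) + η ^ 2 * (2 * Δ * N) := by
        rw [hQ]; field_simp
      rw [mul_add, this]
      linarith
    exact le_of_mul_le_mul_left h4 hη0
  rw [hdiff]
  have ho := key o
  have hi := key i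
  rcases le_total (cumReward A y o n - M) 0 with h | h
  · nlinarith
  · nlinarith

end ExpWeights

/-! ### A tree of exponential weights -/

/-- The grid of bid thresholds. -/
def threshold (D c : ℕ) : I := Set.projIcc (0 : ℝ) 1 zero_le_one (2 * c / 2 ^ D)

/-- The reward in round `t` of bidding the threshold `c` (but at most the value); the sequence
`z` lists the values and the competing bids. -/
def thresholdReward (D : ℕ) (z : ℕ → I × I) (t c : ℕ) : ℝ :=
  reward (min (z t).1 (threshold D c)) (z t).1 (z t).2

/-- The dyadic cell of level `l` of a value. -/
def cell (l : ℕ) (v : I) : ℕ := ⌊(v : ℝ) / 2 * 2 ^ l⌋₊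

/-- The weights of the thresholds at a node of height `d` with bid window
`[k * 2 ^ d, (k + 2) * 2 ^ d]`: exponential weights, run separately in every cell, over the
three windows of half the length and the constant bid at the top of the window. -/
def treeWeight (D : ℕ) (η : ℕ → ℝ) (z : ℕ → I × I) : ℕ → ℕ → ℕ → ℕ → ℝ
  | 0, k, _, c => if c = k + 2 then 1 else 0
  | d + 1, k, t, c => ∑ i : Option (Fin 3),
      expWeight (η d) (fun s => cell (D - d) (z s).1 = cell (D - d) (z t).1)
        (fun (i : Option (Fin 3)) s => ∑ c ∈ Finset.range (2 * 2 ^ D + 1),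
          i.elim (if c = (k + 2) * 2 ^ (d + 1) then 1 else 0)
            (fun j => treeWeight D η z d (2 * k + j) s c) * thresholdReward D z s c) i t *
      i.elim (if c = (k + 2) * 2 ^ (d + 1) then 1 else 0)
        (fun j => treeWeight D η z d (2 * k + j) t c)

/-- The weights recommended by an expert of a node of height `d + 1`. -/
def treeExpert (D : ℕ) (η : ℕ → ℝ) (z : ℕ → I × I) (d k : ℕ) (i : Option (Fin 3))
    (t c : ℕ) : ℝ :=
  i.elim (if c = (k + 2) * 2 ^ (d + 1) then 1 else 0)
    (fun j => treeWeight D η z d (2 * k + j) t c)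

/-- The expected reward of an expert. -/
def expertReward (D : ℕ) (η : ℕ → ℝ) (z : ℕ → I × I) (d k : ℕ) (i : Option (Fin 3))
    (t : ℕ) : ℝ :=
  ∑ c ∈ Finset.range (2 * 2 ^ D + 1), treeExpert D η z d k i t c * thresholdReward D z t c

/-- The expected reward of a node. -/
def treeReward (D : ℕ) (η : ℕ → ℝ) (z : ℕ → I × I) (d k t : ℕ) : ℝ :=
  ∑ c ∈ Finset.range (2 * 2 ^ D + 1), treeWeight D η z d k t c * thresholdReward D z t c

variable (D : ℕ) (η : ℕ → ℝ) (z : ℕ → I × I)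

theorem treeWeight_succ (d k t c : ℕ) :
    treeWeight D η z (d + 1) k t c = ∑ i : Option (Fin 3),
      expWeight (η d) (fun s => cell (D - d) (z s).1 = cell (D - d) (z t).1)
        (expertReward D η z d k) i t * treeExpert D η z d k i t c := rfl

theorem treeReward_succ (d k t : ℕ) :
    treeReward D η z (d + 1) k t = ∑ i : Option (Fin 3),
      expWeight (η d) (fun s => cell (D - d) (z s).1 = cell (D - d) (z t).1)
        (expertReward D η z d k) i t * expertReward D η z d k i t := by
  simp only [treeReward, treeWeight_succ, expertReward, Finset.sum_mul, Finset.mul_sum]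
  rw [Finset.sum_comm]
  simp only [mul_assoc]

theorem expertReward_some (d k : ℕ) (j : Fin 3) (t : ℕ) :
    expertReward D η z d k (some j) t = treeReward D η z d (2 * k + j) t := rfl

theorem treeWeight_nonneg (d k t c : ℕ) : 0 ≤ treeWeight D η z d k t c := by
  induction d generalizing k with
  | zero => unfold treeWeight; positivity
  | succ d ih =>
    rw [treeWeight_succ]
    refine Finset.sum_nonneg fun i _ => mul_nonneg (expWeight_nonneg _ _ _ _ _) ?_
    cases i with
    | none => simp only [treeExpert, Option.elim]; positivity
    | some j => exact ih _

theorem treeExpert_nonneg (d k : ℕ) (i : Option (Fin 3)) (t c : ℕ) :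
    0 ≤ treeExpert D η z d k i t c := by
  cases i with
  | none => simp only [treeExpert, Option.elim]; positivity
  | some j => exact treeWeight_nonneg _ _ _ _ _ _ _

/-- Relative to the claim at height `d`, so that it can serve as the inductive step of
`treeWeight_support`. The three child windows start at `2 * k`, `2 * k + 1`, `2 * k + 2` and stay
inside the parent window. -/
theorem treeExpert_support_of {d : ℕ} (h : ∀ {k t c : ℕ}, treeWeight D η z d k t c ≠ 0 →
    k * 2 ^ d ≤ c ∧ c ≤ (k + 2) * 2 ^ d) {k : ℕ} {i : Option (Fin 3)} {t c : ℕ}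
    (hc : treeExpert D η z d k i t c ≠ 0) :
    k * 2 ^ (d + 1) ≤ c ∧ c ≤ (k + 2) * 2 ^ (d + 1) := by
  cases i with
  | none =>
    have : c = (k + 2) * 2 ^ (d + 1) := by
      by_contra hne
      simp [treeExpert, hne] at hc
    subst this
    exact ⟨Nat.mul_le_mul_right _ (by omega), le_rfl⟩
  | some j =>
    obtain ⟨h1, h2⟩ := h hc
    have hj : (j : ℕ) ≤ 2 := by omega
    rw [pow_succ]
    constructor
    · calc k * (2 ^ d * 2) = 2 * k * 2 ^ d := by ring
        _ ≤ (2 * k + j) * 2 ^ d := Nat.mul_le_mul_right _ (by omega)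
        _ ≤ c := h1
    · calc c ≤ (2 * k + j + 2) * 2 ^ d := h2
        _ ≤ (2 * k + 4) * 2 ^ d := Nat.mul_le_mul_right _ (by omega)
        _ = (k + 2) * (2 ^ d * 2) := by ring

theorem treeWeight_support {d k t c : ℕ} (hc : treeWeight D η z d k t c ≠ 0) :
    k * 2 ^ d ≤ c ∧ c ≤ (k + 2) * 2 ^ d := by
  induction d generalizing k t c with
  | zero =>
    have : c = k + 2 := by
      by_contra hne
      simp [treeWeight, hne] at hc
    subst this
    simp
  | succ d ih =>
    rw [treeWeight_succ] at hc
    obtain ⟨i, -, hi⟩ := Finset.exists_ne_zero_of_sum_ne_zero hc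
    exact treeExpert_support_of D η z ih (right_ne_zero_of_mul hi)

theorem treeExpert_support {d k : ℕ} {i : Option (Fin 3)} {t c : ℕ}
    (hc : treeExpert D η z d k i t c ≠ 0) :
    k * 2 ^ (d + 1) ≤ c ∧ c ≤ (k + 2) * 2 ^ (d + 1) :=
  treeExpert_support_of D η z (treeWeight_support D η z) hc

theorem sum_treeExpert_of {d : ℕ} (h : ∀ {k t : ℕ}, (k + 2) * 2 ^ d ≤ 2 * 2 ^ D →
      ∑ c ∈ Finset.range (2 * 2 ^ D + 1), treeWeight D η z d k t c = 1) {k : ℕ}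
    (hk : (k + 2) * 2 ^ (d + 1) ≤ 2 * 2 ^ D) (i : Option (Fin 3)) (t : ℕ) :
    ∑ c ∈ Finset.range (2 * 2 ^ D + 1), treeExpert D η z d k i t c = 1 := by
  cases i with
  | none =>
    simp only [treeExpert, Option.elim]
    rw [Finset.sum_ite_eq', if_pos (Finset.mem_range.2 (by omega))]
  | some j =>
    refine h (le_trans ?_ hk)
    have hj : (j : ℕ) ≤ 2 := by omega
    calc (2 * k + j + 2) * 2 ^ d ≤ (2 * k + 4) * 2 ^ d := Nat.mul_le_mul_right _ (by omega)
      _ = (k + 2) * 2 ^ (d + 1) := by ring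

theorem sum_treeWeight {d k t : ℕ} (hk : (k + 2) * 2 ^ d ≤ 2 * 2 ^ D) :
    ∑ c ∈ Finset.range (2 * 2 ^ D + 1), treeWeight D η z d k t c = 1 := by
  induction d generalizing k t with
  | zero =>
    simp only [treeWeight]
    rw [Finset.sum_ite_eq', if_pos (Finset.mem_range.2 (by omega))]
  | succ d ih =>
    simp only [treeWeight_succ]
    rw [Finset.sum_comm]
    simp only [← Finset.mul_sum, sum_treeExpert_of D η z ih hk, mul_one]
    exact sum_expWeight _ _ _ _

theorem sum_treeExpert {d k : ℕ} (hk : (k + 2) * 2 ^ (d + 1) ≤ 2 * 2 ^ D)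
    (i : Option (Fin 3)) (t : ℕ) :
    ∑ c ∈ Finset.range (2 * 2 ^ D + 1), treeExpert D η z d k i t c = 1 :=
  sum_treeExpert_of D η z (sum_treeWeight D η z) hk i t

theorem thresholdReward_nonneg (t c : ℕ) : 0 ≤ thresholdReward D z t c :=
  reward_nonneg (min_le_left _ _) _

theorem expertReward_nonneg (d k : ℕ) (i : Option (Fin 3)) (t : ℕ) :
    0 ≤ expertReward D η z d k i t :=
  Finset.sum_nonneg fun _ _ =>
    mul_nonneg (treeExpert_nonneg _ _ _ _ _ _ _ _) (thresholdReward_nonneg _ _ _ _)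

theorem expertReward_le_one {d k : ℕ} (hk : (k + 2) * 2 ^ (d + 1) ≤ 2 * 2 ^ D)
    (i : Option (Fin 3)) (t : ℕ) : expertReward D η z d k i t ≤ 1 := by
  rw [← sum_treeExpert D η z hk i t]
  exact Finset.sum_le_sum fun c _ => mul_le_of_le_one_right
    (treeExpert_nonneg _ _ _ _ _ _ _ _) (reward_le_one _ _ _)

theorem coe_threshold (c : ℕ) : ((threshold D c : I) : ℝ) = min (1 : ℝ) (2 * (c : ℝ) / 2 ^ D) := by
  rw [threshold, Set.coe_projIcc, max_eq_right (by positivity)]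

theorem thresholdReward_le (t : ℕ) {b : I} (hb : b ≤ (z t).1) {c : ℕ} {r : ℝ}
    (h1 : (b : ℝ) ≤ 2 * c / 2 ^ D) (h2 : 2 * c / 2 ^ D ≤ (b : ℝ) + r) :
    reward b (z t).1 (z t).2 ≤ thresholdReward D z t c + r := by
  have hbc : b ≤ min (z t).1 (threshold D c) := by
    refine le_min hb ?_
    rw [← Subtype.coe_le_coe, coe_threshold]
    exact le_min b.2.2 h1
  have h := reward_le_add_sub hbc (min_le_left _ _) (z t).2
  have h3 : ((min (z t).1 (threshold D c) : I) : ℝ) ≤ 2 * c / 2 ^ D :=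
    (Subtype.coe_le_coe.2 (min_le_right _ _)).trans
      ((coe_threshold D c).le.trans (min_le_right _ _))
  unfold thresholdReward
  linarith

theorem thresholdReward_le_of_le (t : ℕ) {c c' : ℕ} (h : c ≤ c') :
    thresholdReward D z t c ≤ thresholdReward D z t c' + 2 * ((c' : ℝ) - c) / 2 ^ D := by
  have hc : (c : ℝ) ≤ c' := by exact_mod_cast h
  have hmono : threshold D c ≤ threshold D c' := by
    refine Set.monotone_projIcc _ ?_
    gcongr
  have h1 := reward_le_add_sub (min_le_min_left (z t).1 hmono) (min_le_left _ _) (z t).2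
  refine h1.trans (add_le_add_right ?_ _)
  have h2 : (0 : ℝ) ≤ 2 * ((c' : ℝ) - c) / 2 ^ D :=
    div_nonneg (by linarith) (by positivity)
  have h3 : ((threshold D c' : I) : ℝ) ≤ (threshold D c : I) + 2 * ((c' : ℝ) - c) / 2 ^ D := by
    rw [coe_threshold, coe_threshold, ← min_add_add_right]
    refine min_le_min (by linarith) (le_of_eq ?_)
    ring
  have h4 : ((min (z t).1 (threshold D c') : I) : ℝ)
      = min ((z t).1 : ℝ) (threshold D c' : I) := rfl
  have h5 : ((min (z t).1 (threshold D c) : I) : ℝ)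
      = min ((z t).1 : ℝ) (threshold D c : I) := rfl
  rw [h4, h5, sub_le_iff_le_add', ← min_add_add_right]
  exact min_le_min (by linarith) h3

/-- The constant bid at the top of the window is a good expert. -/
theorem expertReward_le_top {d k : ℕ} (hk : (k + 2) * 2 ^ (d + 1) ≤ 2 * 2 ^ D)
    (i : Option (Fin 3)) (t : ℕ) :
    expertReward D η z d k i t ≤ expertReward D η z d k none t + 4 * 2 ^ (d + 1) / 2 ^ D := by
  have hnone : expertReward D η z d k none t
      = thresholdReward D z t ((k + 2) * 2 ^ (d + 1)) := by
    simp only [expertReward, treeExpert, Option.elim, ite_mul, one_mul, zero_mul]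
    rw [Finset.sum_ite_eq', if_pos (Finset.mem_range.2 (by omega))]
  rw [hnone]
  set g := thresholdReward D z t ((k + 2) * 2 ^ (d + 1)) + 4 * 2 ^ (d + 1) / 2 ^ D
  calc expertReward D η z d k i t
      ≤ ∑ c ∈ Finset.range (2 * 2 ^ D + 1), treeExpert D η z d k i t c * g := by
        refine Finset.sum_le_sum fun c _ => ?_
        by_cases h0 : treeExpert D η z d k i t c = 0
        · rw [h0, zero_mul, zero_mul]
        · obtain ⟨h1, h2⟩ := treeExpert_support D η z h0
          refine mul_le_mul_of_nonneg_left ?_ (treeExpert_nonneg _ _ _ _ _ _ _ _)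
          -- Every bid the expert uses lies in the window, so raising it to the top costs at most
          -- the window's length.
          refine (thresholdReward_le_of_le D z t h2).trans (add_le_add_right ?_ _)
          have h1' : (k : ℝ) * 2 ^ (d + 1) ≤ c := by exact_mod_cast h1
          push_cast
          exact div_le_div_of_nonneg_right (by linarith) (by positivity)
    _ = g := by rw [← Finset.sum_mul, sum_treeExpert D η z hk, one_mul]

/-! ### The path of a comparator through the tree -/

theorem cell_succ_div_two (l : ℕ) (v : I) : cell (l + 1) v / 2 = cell l v := by
  unfold cell
  have := Nat.floor_div_natCast ((v : ℝ) / 2 * 2 ^ (l + 1)) 2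
  rw [← this, pow_succ]
  congr 1
  push_cast
  ring

theorem cell_le (l : ℕ) (v : I) : (cell l v : ℝ) / 2 ^ l ≤ (v : ℝ) / 2 := by
  rw [div_le_iff₀ (by positivity)]
  exact Nat.floor_le (by have := v.2.1; positivity)

theorem lt_cell (l : ℕ) (v : I) : (v : ℝ) / 2 < ((cell l v : ℝ) + 1) / 2 ^ l := by
  rw [lt_div_iff₀ (by positivity)]
  exact Nat.lt_floor_add_one _

theorem cell_lt (l : ℕ) (v : I) : cell l v < 2 ^ l := by
  have h1 := cell_le l v
  rw [div_le_iff₀ (by positivity)] at h1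
  have h2 : (cell l v : ℝ) < (2 ^ l : ℕ) := by
    push_cast
    have : (0 : ℝ) < 2 ^ l := by positivity
    nlinarith [v.2.2]
  exact_mod_cast h2

/-- The window of level `l` that a comparator `g` uses in the cell `c`. -/
def window (g : ℝ → ℝ) (l c : ℕ) : ℕ := ⌊g (c / 2 ^ l) * 2 ^ l⌋₊

/-- Increasing 1-Lipschitz functions on `[0, ∞)` that vanish at `0`. -/
structure IsComparator (g : ℝ → ℝ) : Prop where
  map_zero : g 0 = 0
  mono : ∀ ⦃x y⦄, 0 ≤ x → x ≤ y → g x ≤ g y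
  lip : ∀ ⦃x y⦄, 0 ≤ x → x ≤ y → g y ≤ g x + (y - x)

variable {g : ℝ → ℝ}

theorem IsComparator.nonneg (hg : IsComparator g) {x : ℝ} (hx : 0 ≤ x) : 0 ≤ g x :=
  hg.map_zero.symm.le.trans (hg.mono le_rfl hx)

theorem IsComparator.window_le (hg : IsComparator g) (l c : ℕ) :
    (window g l c : ℝ) ≤ g (c / 2 ^ l) * 2 ^ l :=
  Nat.floor_le (mul_nonneg (hg.nonneg (by positivity)) (by positivity))

theorem lt_window (g : ℝ → ℝ) (l c : ℕ) : g (c / 2 ^ l) * 2 ^ l < window g l c + 1 :=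
  Nat.lt_floor_add_one _

theorem IsComparator.window_zero (hg : IsComparator g) : window g 0 0 = 0 := by
  simp [window, hg.map_zero]

/-- The left endpoint of a half-cell is that of its parent or lies `1 / 2 ^ (l + 1)` to the right,
so `g` grows by at most one unit of the finer scale; rounding down adds at most one more. Hence
three children suffice. -/
theorem IsComparator.exists_window_succ (hg : IsComparator g) (l c : ℕ) :
    ∃ j : Fin 3, window g (l + 1) c = 2 * window g l (c / 2) + j := by
  have h2 : (0 : ℝ) < 2 ^ l := by positivity
  have hc1 : 2 * (c / 2) ≤ c := by omega
  have hc2 : c ≤ 2 * (c / 2) + 1 := by omega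
  have hc1' : 2 * ((c / 2 : ℕ) : ℝ) ≤ c := by exact_mod_cast hc1
  have hc2' : (c : ℝ) ≤ 2 * ((c / 2 : ℕ) : ℝ) + 1 := by exact_mod_cast hc2
  have hx0 : (0 : ℝ) ≤ ((c / 2 : ℕ) : ℝ) / 2 ^ l := by positivity
  have hxy : ((c / 2 : ℕ) : ℝ) / 2 ^ l ≤ (c : ℝ) / 2 ^ (l + 1) := by
    rw [pow_succ, div_le_div_iff₀ h2 (by positivity)]
    nlinarith
  have hyx : (c : ℝ) / 2 ^ (l + 1) - ((c / 2 : ℕ) : ℝ) / 2 ^ l ≤ 1 / 2 ^ (l + 1) := by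
    rw [pow_succ]
    have : ((c / 2 : ℕ) : ℝ) / 2 ^ l = 2 * ((c / 2 : ℕ) : ℝ) / (2 ^ l * 2) := by field_simp
    rw [this, ← sub_div]
    gcongr
    linarith
  have hlo : 2 * window g l (c / 2) ≤ window g (l + 1) c := by
    refine Nat.le_floor ?_
    have h1 := hg.window_le l (c / 2)
    have h3 := hg.mono hx0 hxy
    push_cast
    calc 2 * (window g l (c / 2) : ℝ) ≤ 2 * (g ((c / 2 : ℕ) / 2 ^ l) * 2 ^ l) := by linarith
      _ = g ((c / 2 : ℕ) / 2 ^ l) * 2 ^ (l + 1) := by ring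
      _ ≤ g (c / 2 ^ (l + 1)) * 2 ^ (l + 1) := by gcongr
  have hhi : window g (l + 1) c < 2 * window g l (c / 2) + 3 := by
    have h1 := lt_window g l (c / 2)
    have h3 := hg.lip hx0 hxy
    have h4 := hg.window_le (l + 1) c
    have h5 : g (c / 2 ^ (l + 1)) * 2 ^ (l + 1)
        ≤ (g ((c / 2 : ℕ) / 2 ^ l) + 1 / 2 ^ (l + 1)) * 2 ^ (l + 1) := by
      gcongr; linarith
    rw [add_mul, one_div, inv_mul_cancel₀ (by positivity)] at h5
    have h6 : g ((c / 2 : ℕ) / 2 ^ l) * 2 ^ (l + 1) = 2 * (g ((c / 2 : ℕ) / 2 ^ l) * 2 ^ l) := by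
      ring
    have h7 : (window g (l + 1) c : ℝ) < 2 * window g l (c / 2) + 3 := by linarith
    exact_mod_cast h7
  exact ⟨⟨window g (l + 1) c - 2 * window g l (c / 2), by omega⟩, by simp only; omega⟩

/-- Windows on the comparator's path stay within the grid of thresholds, which is what makes the
weights of their nodes sum to `1`. -/
theorem IsComparator.window_add_two_le (hg : IsComparator g) (l : ℕ) {c : ℕ} (hc : c < 2 ^ l) :
    window g l c + 2 ≤ 2 * 2 ^ l := by
  induction l generalizing c with
  | zero =>
    have : c = 0 := by simpa using hc
    rw [this, hg.window_zero]
    norm_num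
  | succ l ih =>
    obtain ⟨j, hj⟩ := hg.exists_window_succ l c
    have := ih (c := c / 2) (by rw [pow_succ] at hc; omega)
    have hj2 : (j : ℕ) ≤ 2 := by omega
    rw [hj, pow_succ]
    omega

/-- The regret of the nodes of one level against their best experts. -/
theorem level_regret (hg : IsComparator g) {l d : ℕ} (hD : l + (d + 1) = D) (n : ℕ)
    (hη0 : 0 < η d) (hη1 : η d ≤ 1 / 2) :
    ∑ t ∈ Finset.range n, (treeReward D η z d (window g (l + 1) (cell (l + 1) (z t).1)) t
        - treeReward D η z (d + 1) (window g l (cell l (z t).1)) t)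
      ≤ 2 ^ (l + 1) * (2 * (Real.log 4 / η d)) + 2 * (2 * η d * (4 / 2 ^ l) * n) := by
  have hDd : D - d = l + 1 := by omega
  have hΔ : (4 : ℝ) * 2 ^ (d + 1) / 2 ^ D = 4 / 2 ^ l := by
    rw [← hD]
    field_simp
    ring
  have hcell : ∀ c ∈ Finset.range (2 ^ (l + 1)),
      ∑ t ∈ (Finset.range n).filter (fun t => cell (l + 1) (z t).1 = c),
        (treeReward D η z d (window g (l + 1) (cell (l + 1) (z t).1)) t
          - treeReward D η z (d + 1) (window g l (cell l (z t).1)) t)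
      ≤ 2 * (Real.log 4 / η d + 2 * η d * (4 / 2 ^ l) *
        ∑ t ∈ Finset.range n, if cell (l + 1) (z t).1 = c then 1 else 0) := by
    intro c hc
    -- Within one cell of level `l + 1` the comparator's parent node and child are fixed, so this is
    -- the regret against the single expert `some j`.
    obtain ⟨j, hj⟩ := hg.exists_window_succ l c
    set k := window g l (c / 2) with hk
    have hk2 : (k + 2) * 2 ^ (d + 1) ≤ 2 * 2 ^ D := by
      have h1 := hg.window_add_two_le l (c := c / 2) (by
        have := Finset.mem_range.1 hc
        rw [pow_succ] at this
        omega)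
      calc (k + 2) * 2 ^ (d + 1) ≤ (2 * 2 ^ l) * 2 ^ (d + 1) := Nat.mul_le_mul_right _ h1
        _ = 2 * 2 ^ D := by rw [← hD, pow_add 2 l]; ring
    have h := expWeight_regret (A := fun t => cell (l + 1) (z t).1 = c)
      (y := expertReward D η z d k) (o := none) hη0 hη1 (expertReward_nonneg D η z d k)
      (expertReward_le_one D η z hk2) (fun i t => expertReward_le_top D η z hk2 i t) (some j) n
    rw [hΔ] at h
    have hcard : (Fintype.card (Option (Fin 3)) : ℝ) = 4 := by norm_num
    rw [hcard] at h
    rw [Finset.sum_filter]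
    refine le_trans (le_of_eq (Finset.sum_congr rfl fun t _ => ?_)) h
    split_ifs with ht
    · have hl : cell l (z t).1 = c / 2 := by rw [← cell_succ_div_two, ht]
      rw [ht, hl, hj, ← hk, ← expertReward_some, treeReward_succ, hDd]
      simp only [ht]
    · rfl
  -- Each of the `2 ^ (l + 1)` cells pays the logarithmic term, whereas their active rounds add up
  -- to `n`.
  rw [← Finset.sum_fiberwise_of_maps_to (t := Finset.range (2 ^ (l + 1)))
    (g := fun t => cell (l + 1) (z t).1) fun t _ => Finset.mem_range.2 (cell_lt _ _)]
  refine (Finset.sum_le_sum hcell).trans (le_of_eq ?_)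
  have hone : ∑ c ∈ Finset.range (2 ^ (l + 1)), ∑ t ∈ Finset.range n,
      (if cell (l + 1) (z t).1 = c then (1 : ℝ) else 0) = n := by
    rw [Finset.sum_comm]
    have : ∀ t ∈ Finset.range n, ∑ c ∈ Finset.range (2 ^ (l + 1)),
        (if cell (l + 1) (z t).1 = c then (1 : ℝ) else 0) = 1 := by
      intro t _
      rw [Finset.sum_ite_eq, if_pos (Finset.mem_range.2 (cell_lt _ _))]
    rw [Finset.sum_congr rfl this]
    simp
  rw [← Finset.mul_sum, Finset.sum_add_distrib, ← Finset.mul_sum, hone]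
  simp
  ring

theorem treeReward_zero {k : ℕ} (hk : k + 2 ≤ 2 * 2 ^ D) (t : ℕ) :
    treeReward D η z 0 k t = thresholdReward D z t (k + 2) := by
  simp only [treeReward, treeWeight, ite_mul, one_mul, zero_mul]
  rw [Finset.sum_ite_eq', if_pos (Finset.mem_range.2 (by omega))]

/-- The regret of the root against a comparator `g` (rescaled by `2`). -/
theorem tree_regret (hg : IsComparator g) (n : ℕ) {R : ℝ}
    (hη0 : ∀ d < D, 0 < η d) (hη1 : ∀ d < D, η d ≤ 1 / 2)
    (hR : ∀ l d, l + (d + 1) = D →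
      2 ^ (l + 1) * (2 * (Real.log 4 / η d)) + 2 * (2 * η d * (4 / 2 ^ l) * n) ≤ R)
    (b : ℕ → I) (hb : ∀ t, (b t : ℝ) = 2 * g ((z t).1 / 2)) (hbz : ∀ t, b t ≤ (z t).1) :
    ∑ t ∈ Finset.range n, reward (b t) (z t).1 (z t).2
      ≤ ∑ t ∈ Finset.range n, treeReward D η z D 0 t + (D * R + n * (4 / 2 ^ D)) := by
  -- The reward of following the comparator's path down to level `l` and the algorithm below it: `U
  -- 0` is the root, `U D` the leaves, and each increment is one `level_regret`.
  let U : ℕ → ℝ := fun l =>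
    ∑ t ∈ Finset.range n, treeReward D η z (D - l) (window g l (cell l (z t).1)) t
  have hU : U D - U 0 ≤ D * R := by
    rw [← Finset.sum_range_sub]
    refine (Finset.sum_le_card_nsmul _ _ R fun l hl => ?_).trans (by simp)
    have hl' := Finset.mem_range.1 hl
    obtain ⟨d, hd⟩ : ∃ d, l + (d + 1) = D := ⟨D - l - 1, by omega⟩
    simp only [U]
    rw [← Finset.sum_sub_distrib, show D - (l + 1) = d by omega, show D - l = d + 1 by omega]
    exact (level_regret D η z hg hd n (hη0 d (by omega)) (hη1 d (by omega))).trans (hR l d hd)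
  have hU0 : U 0 = ∑ t ∈ Finset.range n, treeReward D η z D 0 t := by
    refine Finset.sum_congr rfl fun t _ => ?_
    have : cell 0 (z t).1 = 0 := by simpa using cell_lt 0 (z t).1
    rw [this, hg.window_zero, Nat.sub_zero]
  have hUD : ∑ t ∈ Finset.range n, reward (b t) (z t).1 (z t).2 ≤ U D + n * (4 / 2 ^ D) := by
    have : (n : ℝ) * (4 / 2 ^ D) = ∑ _t ∈ Finset.range n, (4 : ℝ) / 2 ^ D := by simp
    rw [this, ← Finset.sum_add_distrib]
    refine Finset.sum_le_sum fun t _ => ?_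
    rw [Nat.sub_self, treeReward_zero D η z (hg.window_add_two_le D (cell_lt _ _))]
    have h2 : (0 : ℝ) < 2 ^ D := by positivity
    have h1 := hg.window_le D (cell D (z t).1)
    have h3 := lt_window g D (cell D (z t).1)
    have h4 := cell_le D (z t).1
    have h5 := lt_cell D (z t).1
    have h6 := hg.mono (by positivity) h4
    have h7 := hg.lip (by positivity) h4
    rw [add_div] at h5
    rw [← div_le_iff₀ h2] at h1
    rw [← lt_div_iff₀ h2, add_div] at h3
    have e1 : (2 : ℝ) * ((window g D (cell D (z t).1) + 2 : ℕ) : ℝ) / 2 ^ D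
        = 2 * (window g D (cell D (z t).1) / 2 ^ D) + 4 * (1 / 2 ^ D) := by push_cast; ring
    have e2 : (4 : ℝ) / 2 ^ D = 4 * (1 / 2 ^ D) := by ring
    -- The leaf bids the top of its window, which lies above the comparator's bid by at most the
    -- window's length `4 / 2 ^ D`.
    refine thresholdReward_le D z t (hbz t) ?_ ?_
    · rw [hb, e1]; linarith
    · rw [hb, e1, e2]; linarith
  linarith

end Tree

/-! ### The tree as a hint-free policy, its regret, and the minimax regret. -/

section TreePolicy

/-! ### The tree as a policy -/

variable (D : ℕ) (η : ℕ → ℝ)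

/-- The weights of round `t` depend only on the past and on the current value. -/
theorem treeWeight_congr {z z' : ℕ → I × I} (d : ℕ) {k t c : ℕ} (h : ∀ s < t, z s = z' s)
    (ht : (z t).1 = (z' t).1) : treeWeight D η z d k t c = treeWeight D η z' d k t c := by
  induction d generalizing k t c with
  | zero => rfl
  | succ d ih =>
    have hexp : ∀ i s c, s ≤ t → treeExpert D η z d k i s c = treeExpert D η z' d k i s c := by
      intro i s c hs
      cases i with
      | none => rfl
      | some j =>
        refine ih (fun r hr => h r (by omega)) ?_
        rcases hs.eq_or_lt with rfl | hs
        · exact ht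
        · rw [h s hs]
    have hrew : ∀ i s, s < t → expertReward D η z d k i s = expertReward D η z' d k i s := by
      intro i s hs
      refine Finset.sum_congr rfl fun c _ => ?_
      rw [hexp i s c hs.le, thresholdReward, thresholdReward, h s hs]
    have hcum : ∀ i, cumReward (fun s => cell (D - d) (z s).1 = cell (D - d) (z t).1)
        (expertReward D η z d k) i t
        = cumReward (fun s => cell (D - d) (z' s).1 = cell (D - d) (z' t).1)
        (expertReward D η z' d k) i t := by
      intro i
      refine Finset.sum_congr rfl fun s hs => ?_
      have hs := Finset.mem_range.1 hs
      simp only [hrew i s hs, h s hs, ht]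
    rw [treeWeight_succ, treeWeight_succ]
    refine Finset.sum_congr rfl fun i _ => ?_
    rw [hexp i t c le_rfl, expWeight, expWeight]
    simp only [hcum]

theorem measurable_cell (l : ℕ) : Measurable (cell l) :=
  Nat.measurable_floor.comp ((measurable_subtype_coe.div_const _).mul_const _)

theorem measurable_treeWeight (d k t c : ℕ) :
    Measurable fun z : ℕ → I × I => treeWeight D η z d k t c := by
  induction d generalizing k t c with
  | zero => exact measurable_const
  | succ d ih =>
    have hexp : ∀ i t c, Measurable fun z : ℕ → I × I => treeExpert D η z d k i t c := by
      intro i t c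
      cases i with
      | none => exact measurable_const
      | some j => exact ih _ _ _
    have hthr : ∀ t c, Measurable fun z : ℕ → I × I => thresholdReward D z t c := by
      intro t c
      have hv : Measurable fun z : ℕ → I × I => (z t).1 := by fun_prop
      have hm : Measurable fun z : ℕ → I × I => (z t).2 := by fun_prop
      exact measurable_reward.comp ((hv.min measurable_const).prodMk (hv.prodMk hm))
    have hrew : ∀ i t, Measurable fun z : ℕ → I × I => expertReward D η z d k i t :=
      fun i t => Finset.measurable_sum _ fun c _ => (hexp i t c).mul (hthr t c)
    have hcell : ∀ t, Measurable fun z : ℕ → I × I => cell (D - d) (z t).1 :=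
      fun t => (measurable_cell _).comp (by fun_prop)
    have hcum : ∀ i, Measurable fun z : ℕ → I × I =>
        cumReward (fun s => cell (D - d) (z s).1 = cell (D - d) (z t).1)
          (expertReward D η z d k) i t := by
      intro i
      refine Finset.measurable_sum _ fun s _ => Measurable.ite ?_ (hrew i s) measurable_const
      exact measurableSet_eq_fun (hcell s) (hcell t)
    simp only [treeWeight_succ]
    refine Finset.measurable_sum _ fun i _ => Measurable.mul ?_ (hexp i t c)
    exact ((hcum i).const_mul _).exp.div
      (Finset.measurable_sum _ fun j _ => ((hcum j).const_mul _).exp)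

/-- The values and competing bids recorded in an observation. -/
def Observation.history {t : ℕ} (o : Observation t) (s : ℕ) : I × I :=
  -- Entries not yet observed are `0`, in particular the current competing bid; by
  -- `treeWeight_congr` they do not affect the weights of round `t`.
  (if h : s < t + 1 then (o.1 ⟨s, h⟩).1 else 0, if h : s < t then o.2 ⟨s, h⟩ else 0)

theorem Observation.measurable_history (t : ℕ) :
    Measurable (Observation.history : Observation t → ℕ → I × I) := by
  refine measurable_pi_lambda _ fun s => Measurable.prodMk ?_ ?_
  · by_cases h : s < t + 1
    · simp only [h, dif_pos]; fun_prop
    · simp only [h, dif_neg, not_false_eq_true]; exact measurable_const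
  · by_cases h : s < t
    · simp only [h, dif_pos]; fun_prop
    · simp only [h, dif_neg, not_false_eq_true]; exact measurable_const

theorem Observation.measurable_value (t : ℕ) :
    Measurable (Observation.value : Observation t → I) :=
  measurable_fst.comp ((measurable_pi_apply _).comp measurable_fst)

/-- The kernel that chooses the point `b c` with probability `w c`, for `c < N`. -/
def mixtureKernel {α β : Type*} [MeasurableSpace α] [MeasurableSpace β] (N : ℕ)
    (w : ℕ → α → ℝ) (hw : ∀ c, Measurable (w c)) (b : ℕ → α → β) (hb : ∀ c, Measurable (b c)) :
    Kernel α β where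
  toFun a := ∑ c ∈ Finset.range N, ENNReal.ofReal (w c a) • Measure.dirac (b c a)
  measurable' := by
    refine Measure.measurable_of_measurable_coe _ fun s hs => ?_
    simp only [Measure.coe_finsetSum, Finset.sum_apply, Measure.smul_apply, smul_eq_mul,
      Measure.dirac_apply' _ hs]
    refine Finset.measurable_sum _ fun c _ => (hw c).ennreal_ofReal.mul ?_
    exact (measurable_one.indicator hs).comp (hb c)

theorem mixtureKernel_apply {α β : Type*} [MeasurableSpace α] [MeasurableSpace β] (N : ℕ)
    (w : ℕ → α → ℝ) (hw : ∀ c, Measurable (w c)) (b : ℕ → α → β) (hb : ∀ c, Measurable (b c))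
    (a : α) : mixtureKernel N w hw b hb a
      = ∑ c ∈ Finset.range N, ENNReal.ofReal (w c a) • Measure.dirac (b c a) := rfl

/-- The policy of the root of the tree. -/
def treePolicy (T : ℕ) : Policy T where
  bid t := mixtureKernel (2 * 2 ^ D + 1) (fun c o => treeWeight D η o.history D 0 t c)
    (fun c => (measurable_treeWeight D η D 0 t c).comp (Observation.measurable_history t))
    (fun c o => min o.value (threshold D c))
    (fun _ => (Observation.measurable_value t).min measurable_const)
  isMarkov t := ⟨fun o => ⟨by
    simp only [mixtureKernel_apply, Measure.coe_finsetSum, Finset.sum_apply, Measure.smul_apply,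
      smul_eq_mul, measure_univ, mul_one]
    rw [← ENNReal.ofReal_sum_of_nonneg fun c _ => treeWeight_nonneg _ _ _ _ _ _ _,
      sum_treeWeight D η _ (by omega), ENNReal.ofReal_one]⟩⟩
  bid_le_value t o := by
    rw [ae_iff, mixtureKernel_apply]
    simp only [Measure.coe_finsetSum, Finset.sum_apply, Measure.smul_apply, smul_eq_mul]
    refine Finset.sum_eq_zero fun c _ => ?_
    have hm : MeasurableSet {b | ¬b ≤ o.value} := measurableSet_Iic.compl
    rw [Measure.dirac_apply' _ hm, Set.indicator_of_notMem, mul_zero]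
    exact fun h => h (min_le_left _ _)

theorem treePolicy_ignoresHints (T : ℕ) : (treePolicy D η T).IgnoresHints := by
  intro t o o' h1 h2
  have hh : o.history = o'.history := by
    funext s
    simp only [Observation.history, h1, h2]
  have hv : o.value = o'.value := h1 _
  simp only [treePolicy, mixtureKernel_apply, hh, hv]

variable {T : ℕ} {q L : ℝ}

/-- The values and competing bids of an environment, as a sequence. -/
def Environment.sequence (E : Environment T q L) (x : Fin T → I × I) (s : ℕ) : I × I :=
  if h : s < T then (E.v ⟨s, h⟩, (x ⟨s, h⟩).1) else 0

theorem expReward_treePolicy (E : Environment T q L) (t : Fin T) (x : Fin T → I × I) :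
    (treePolicy D η T).expReward E t x = treeReward D η (E.sequence x) D 0 t := by
  have hz : E.sequence x t = (E.v t, (x t).1) := by
    simp [Environment.sequence]
  simp only [Policy.expReward, treePolicy, mixtureKernel_apply]
  rw [integral_finsetSum_measure]
  · refine Finset.sum_congr rfl fun c _ => ?_
    rw [integral_smul_measure, integral_dirac,
      ENNReal.toReal_ofReal (treeWeight_nonneg _ _ _ _ _ _ _), smul_eq_mul, thresholdReward, hz]
    congr 1
    refine treeWeight_congr D η D (fun s hs => ?_) ?_
    · have h1 : s < T := hs.trans t.isLt
      have h2 : s < (t : ℕ) + 1 := by omega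
      simp [Observation.history, Environment.observation, Environment.sequence, hs, h1, h2]
    · rw [hz]
      simp [Observation.history, Environment.observation]
  · intro c _
    exact (integrable_dirac (by simp)).smul_measure ENNReal.ofReal_ne_top

/-- An oracle, capped at the value and rescaled by `1 / 2`. -/
theorem isComparator_oracle (a : Oracle) :
    IsComparator fun u => min ((a.1 (Set.projIcc 0 1 zero_le_one (2 * u)) : I) : ℝ) (2 * u) / 2 := by
  constructor
  · have h := (a.1 (Set.projIcc 0 1 zero_le_one (2 * 0))).2.1
    rw [mul_zero] at *
    rw [min_eq_right h, zero_div]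
  · intro x y _ hxy
    have h : a.1 (Set.projIcc 0 1 zero_le_one (2 * x)) ≤ a.1 (Set.projIcc 0 1 zero_le_one (2 * y)) :=
      a.2.1 (Set.monotone_projIcc _ (by linarith))
    have h' : ((a.1 (Set.projIcc 0 1 zero_le_one (2 * x)) : I) : ℝ)
      ≤ a.1 (Set.projIcc 0 1 zero_le_one (2 * y)) := h
    exact div_le_div_of_nonneg_right (min_le_min h' (by linarith)) two_pos.le
  · intro x y _ hxy
    have h := (a.2.2.comp (LipschitzWith.projIcc (zero_le_one (α := ℝ)))).dist_le_mul
      (2 * y) (2 * x)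
    simp only [Function.comp_apply, Subtype.dist_eq, Real.dist_eq, mul_one, NNReal.coe_one,
      one_mul] at h
    rw [abs_of_nonneg (by linarith : 0 ≤ 2 * y - 2 * x)] at h
    have h2 := (abs_le.1 h).2
    have h3 : min ((a.1 (Set.projIcc 0 1 zero_le_one (2 * y)) : I) : ℝ) (2 * y)
        ≤ min ((a.1 (Set.projIcc 0 1 zero_le_one (2 * x)) : I) : ℝ) (2 * x)
          + (2 * y - 2 * x) := by
      rw [← min_add_add_right]
      exact min_le_min (by linarith) (by linarith)
    linarith

theorem regret_treePolicy_le (E : Environment T q L) {R : ℝ}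
    (hη0 : ∀ d < D, 0 < η d) (hη1 : ∀ d < D, η d ≤ 1 / 2)
    (hR : ∀ l d, l + (d + 1) = D →
      2 ^ (l + 1) * (2 * (Real.log 4 / η d)) + 2 * (2 * η d * (4 / 2 ^ l) * T) ≤ R) :
    regret (treePolicy D η T) E ≤ D * R + T * (4 / 2 ^ D) := by
  have := E.isProbability
  have h := regret_le_integral (treePolicy D η T) E (integrable_const (D * R + T * (4 / 2 ^ D)))
    (.of_forall fun x a => by
      have hz : ∀ t : Fin T, E.sequence x t = (E.v t, (x t).1) := fun t => by
        simp [Environment.sequence]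
      have h := tree_regret D η (E.sequence x) (isComparator_oracle a) T hη0 hη1 hR
        (fun t => min (a.1 (E.sequence x t).1) (E.sequence x t).1) (fun t => by
          have e : 2 * (((E.sequence x t).1 : ℝ) / 2) = (E.sequence x t).1 := by ring
          simp only [e, Set.projIcc_val]
          rw [mul_div_cancel₀ _ two_ne_zero]
          rfl) (fun t => min_le_right _ _)
      rw [← Fin.sum_univ_eq_sum_range (fun t => reward
        (min (a.1 (E.sequence x t).1) (E.sequence x t).1) (E.sequence x t).1
          (E.sequence x t).2), ← Fin.sum_univ_eq_sum_range] at h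
      simp only [hz] at h
      simp only [expReward_treePolicy]
      exact (Finset.sum_le_sum fun t _ => reward_le_reward_min _ _ _).trans h)
  simpa using h

/-- About `log √T` levels of cost `20 * √T` each, plus `8 * √T` for the rounding at the leaves. -/
theorem exists_policy_ignoresHints (hT : 1 ≤ T) (q L : ℝ) :
    ∃ π : Policy T, π.IgnoresHints ∧
      worstRegret q L π ≤ 40 * (1 + Real.log T) * √(T : ℝ) := by
  -- Makes `2 ^ D` equal to `√T` up to a factor `2`, so the leaf error `T * (4 / 2 ^ D)` is of order
  -- `√T`.
  set D := Nat.log 2 (Nat.sqrt T) with hD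
  have hT' : (1 : ℝ) ≤ T := by exact_mod_cast hT
  have hs1 : 1 ≤ √(T : ℝ) := Real.one_le_sqrt.2 hT'
  have hs0 : 0 < √(T : ℝ) := by linarith
  have hss : √(T : ℝ) * √(T : ℝ) = T := Real.mul_self_sqrt (by linarith)
  have hsq : Nat.sqrt T ≠ 0 := by
    have := Nat.sqrt_pos.2 hT
    omega
  have hD1 : (2 : ℝ) ^ D ≤ √(T : ℝ) := by
    refine le_trans ?_ Real.nat_sqrt_le_real_sqrt
    exact_mod_cast Nat.pow_log_le_self 2 hsq
  have hD2 : √(T : ℝ) ≤ 2 * 2 ^ D := by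
    refine Real.real_sqrt_le_nat_sqrt_succ.trans ?_
    have h : Nat.sqrt T + 1 ≤ 2 ^ (D + 1) := Nat.lt_pow_succ_log_self one_lt_two _
    rw [pow_succ, mul_comm] at h
    exact_mod_cast h
  have hDlog : (D : ℝ) ≤ 2 * Real.log T := by
    have h1 : (2 : ℝ) ^ D ≤ T := hD1.trans (by nlinarith)
    have h2 := Real.log_le_log (by positivity) h1
    rw [Real.log_pow] at h2
    have h3 := Real.log_two_gt_d9
    have h4 : (0 : ℝ) ≤ D := by positivity
    nlinarith
  have hlog : 0 ≤ Real.log T := Real.log_nonneg hT'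
  have hlog4 : Real.log 4 ≤ 3 / 2 := by
    rw [show (4 : ℝ) = 2 ^ 2 by norm_num, Real.log_pow]
    have := Real.log_two_lt_d9
    push_cast
    linarith
  -- With level `l = D - d - 1`, this balances `2 ^ l / η` against `η * T / 2 ^ l`, making both of
  -- order `√T`; `2 ^ D ≤ √T` ensures `η ≤ 1 / 2`.
  let η : ℕ → ℝ := fun d => 2 ^ (D - d - 1) / (2 * √(T : ℝ))
  refine ⟨treePolicy D η T, treePolicy_ignoresHints D η T, ?_⟩
  refine Real.iSup_le (fun E => ?_) (by positivity)
  have h := regret_treePolicy_le D η E (R := 20 * √(T : ℝ)) (fun d _ => by positivity)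
    (fun d _ => by
      have h1 : (2 : ℝ) ^ (D - d - 1) ≤ 2 ^ D := pow_le_pow_right₀ one_le_two (by omega)
      simp only [η]
      rw [div_le_div_iff₀ (by positivity) two_pos]
      linarith)
    (fun l d hld => by
      have hl : D - d - 1 = l := by omega
      simp only [η, hl]
      have e1 : (2 : ℝ) ^ (l + 1) * (2 * (Real.log 4 / (2 ^ l / (2 * √(T : ℝ)))))
          = 8 * Real.log 4 * √(T : ℝ) := by field_simp; ring
      have e2 : 2 * (2 * ((2 : ℝ) ^ l / (2 * √(T : ℝ))) * (4 / 2 ^ l) * T) = 8 * √(T : ℝ) := by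
        nth_rw 2 [← hss]
        field_simp
        ring
      rw [e1, e2]
      nlinarith)
  refine h.trans ?_
  have h1 : (T : ℝ) * (4 / 2 ^ D) ≤ 8 * √(T : ℝ) := by
    rw [mul_div_assoc', div_le_iff₀ (by positivity)]
    nlinarith
  have h2 : (D : ℝ) * (20 * √(T : ℝ)) ≤ 2 * Real.log T * (20 * √(T : ℝ)) := by gcongr
  nlinarith

/-! ### The minimax regret -/

theorem le_minimaxRegret (hL : 1 ≤ L) (hLT : L ≤ T) (hq : 1 ≤ q) :
    3 / 64 * min (hintRate T q L) (√(T : ℝ)) ≤ minimaxRegret T q L := by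
  have : Nonempty (Policy T) := ⟨hintPolicy T q⟩
  exact le_ciInf fun π => le_worstRegret hL hLT hq π

theorem minimaxRegret_le (hL : 1 ≤ L) (hLT : L ≤ T) (hq : 1 ≤ q) (π : Policy T) :
    minimaxRegret T q L ≤ worstRegret q L π :=
  -- The lower bound valid for every policy also shows that the real infimum is over a set bounded
  -- below.
  ciInf_le ⟨_, by rintro _ ⟨π, rfl⟩; exact le_worstRegret hL hLT hq π⟩ π

end TreePolicy

end FirstPriceAuction

end

/-! ### Combining the three bounds. -/

theorem theorem3 :
    ∃ (c C : ℝ) (k : ℕ), 0 < c ∧ 0 < C ∧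
      ∀ (T : ℕ) (L q : ℝ), 1 ≤ L → L ≤ (T : ℝ) → 1 ≤ q →
        -- the minimax regret, up to powers of `1 + log T`
        c / (1 + Real.log T) ^ k * min (FirstPriceAuction.hintRate T q L) (√(T : ℝ))
            ≤ FirstPriceAuction.minimaxRegret T q L ∧
        FirstPriceAuction.minimaxRegret T q L
            ≤ C * (1 + Real.log T) ^ k * min (FirstPriceAuction.hintRate T q L) (√(T : ℝ)) ∧
        -- below the threshold, only bidding the hint is optimal
        (FirstPriceAuction.hintRate T q L ≤ √(T : ℝ) →
          FirstPriceAuction.worstRegret q L (FirstPriceAuction.hintPolicy T q)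
            ≤ C * (1 + Real.log T) ^ k * FirstPriceAuction.minimaxRegret T q L) ∧
        -- above the threshold, ignoring the hint is optimal
        (√(T : ℝ) ≤ FirstPriceAuction.hintRate T q L →
          ∃ π : FirstPriceAuction.Policy T, π.IgnoresHints ∧
            FirstPriceAuction.worstRegret q L π
              ≤ C * (1 + Real.log T) ^ k * FirstPriceAuction.minimaxRegret T q L) := by

  -- The constant `1000` covers the ratios of upper to lower bound, `3 * 64 / 3 = 64` for the hint
  -- and `40 * 64 / 3` for the tree. A single logarithm is lost, in the tree only.
  refine ⟨3 / 64, 1000, 1, by norm_num, by norm_num, fun T L q hL hLT hq => ?_⟩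
  have hT' : (1 : ℝ) ≤ T := hL.trans hLT
  have hT : 1 ≤ T := by exact_mod_cast hT'
  have hlog : 0 ≤ Real.log T := Real.log_nonneg hT'
  have hs : 0 ≤ √(T : ℝ) := Real.sqrt_nonneg _
  have hr : 0 ≤ FirstPriceAuction.hintRate T q L := by
    unfold FirstPriceAuction.hintRate; positivity
  have hlow := FirstPriceAuction.le_minimaxRegret hL hLT hq
  have hhint := FirstPriceAuction.worstRegret_hintPolicy_le (T := T) (L := L)
    (by omega) (by linarith) hq
  obtain ⟨π, hπ, hreg⟩ := FirstPriceAuction.exists_policy_ignoresHints hT q L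
  have hup := FirstPriceAuction.minimaxRegret_le hL hLT hq
  rw [pow_one]
  refine ⟨?_, ?_, fun h => ?_, fun h => ⟨π, hπ, ?_⟩⟩
  · refine le_trans (mul_le_mul_of_nonneg_right ?_ (le_min hr hs)) hlow
    exact div_le_self (by norm_num) (by linarith)
  · rcases le_total (FirstPriceAuction.hintRate T q L) (√(T : ℝ)) with h | h
    · rw [min_eq_left h]
      refine (hup (FirstPriceAuction.hintPolicy T q)).trans (hhint.trans ?_)
      gcongr
      linarith
    · rw [min_eq_right h]
      refine (hup π).trans (hreg.trans ?_)
      gcongr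
      norm_num
  · rw [min_eq_left h] at hlow
    have h1 : 64 * FirstPriceAuction.minimaxRegret T q L
        ≤ 1000 * (1 + Real.log T) * FirstPriceAuction.minimaxRegret T q L := by
      refine mul_le_mul_of_nonneg_right (by linarith) (by linarith)
    linarith
  · rw [min_eq_right h] at hlow
    have h1 : (1 + Real.log T) * √(T : ℝ)
        ≤ (1 + Real.log T) * (64 / 3 * FirstPriceAuction.minimaxRegret T q L) :=
      mul_le_mul_of_nonneg_left (by linarith) (by linarith)
    have h2 : 0 ≤ (1 + Real.log T) * FirstPriceAuction.minimaxRegret T q L :=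
      mul_nonneg (by linarith) (by linarith)
    linarith
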